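/- For $d\ge 2$ let $\mathcal K_d$ be the set of $d$-dimensional convex bodies, i.e. of the compact convex subsets of $\mathbb R^d$ with non-empty interior. For $C\in\mathcal K_d$ let $j(C)$ be the center of the John ellipsoid of $C$ (the ellipsoid of maximal volume contained in $C$) and $l(C)$ the center of the Löwner ellipsoid of $C$ (the ellipsoid of minimal volume containing $C$). Put $\phi_{j,l}(C)=1$ if $j(C)=l(C)$, and otherwise $$\phi_{j,l}(C)=1-\frac{\|j(C)-l(C)\|_2}{\mathrm{vol}_1(a\cap C)},$$ where $a$ is the line through $j(C)$ and $l(C)$. For $d\ge 2$ let $\varepsilon_d$ be the positive solution $\varepsilon$ of $$\sqrt{1-\tfrac1d}\,\bigl(1-(d+1)\varepsilon^2\bigr)=\bigl(d-1-\tfrac1d\bigr)\varepsilon ,$$ that is, $$\varepsilon_d=\frac{\sqrt{(d-1-\frac1d)^2+4(d+1)(1-\frac1d)}-(d-1-\frac1d)}{2(d+1)\sqrt{1-\frac1d}}.$$ Let $B_2^d$ be the closed Euclidean unit ball of $\mathbb R^d$, let $\Delta_d$ be a regular $d$-dimensional simplex inscribed in $B_2^d$ (all its vertices have norm $1$), and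 let $$C_d=\mathrm{conv}\Bigl[\{-\varepsilon_d\}\times\sqrt{1-\varepsilon_d^2}\,\Delta_d\ \cup\ \bigl\{\sqrt{1-\tfrac1d}\bigr\}\times\tfrac{1}{\sqrt d}B_2^d\Bigr]\subseteq\mathbb R\times\mathbb R^d=\mathbb R^{d+1}.$$ **Theorem.** 1. $C_d\in\mathcal K_{d+1}$ for every $d\ge 2$, and, as $d\to\infty$, $$\phi_{j,l}(C_d)\le\frac{2}{d+1}(1+o(1)),$$ where the $o(1)$ term depends only on $d$ (not on the choice of the simplex $\Delta_d$). 2. For every $d\ge 2$ and every $C\in\mathcal K_d$ we have $\phi_{j,l}(C)\ge\frac{2}{d+1}$, and, as $d\to\infty$, $$\inf_{C\in\mathcal K_d}\phi_{j,l}(C)=\frac{2}{d+1}(1+o(1)).$$ -/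

import Mathlib

open Set Filter Topology MeasureTheory

/-- `R^d` with its Euclidean norm. -/
abbrev Euc (d : ℕ) : Type := EuclideanSpace ℝ (Fin d)

/-- The set `K_d` of `d`-dimensional convex bodies: convex compact subsets of `R^d` with non-empty
interior. -/
def convexBodies (d : ℕ) : Set (Set (Euc d)) :=
  {C | Convex ℝ C ∧ IsCompact C ∧ (interior C).Nonempty}

/-- `E` is a (non-degenerate) ellipsoid with center `c`: the image of the closed Euclidean unit
ball under an invertible affine map `x ↦ A x + c`. -/
def IsEllipsoidAt {d : ℕ} (E : Set (Euc d)) (c : Euc d) : Prop :=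
  ∃ A : Euc d ≃ₗ[ℝ] Euc d, E = (fun x => A x + c) '' Metric.closedBall (0 : Euc d) 1

def IsEllipsoid {d : ℕ} (E : Set (Euc d)) : Prop := ∃ c, IsEllipsoidAt E c

/-- `E` is an ellipsoid of maximal volume inside `C`. -/
def IsJohnEllipsoid {d : ℕ} (C E : Set (Euc d)) : Prop :=
  IsEllipsoid E ∧ E ⊆ C ∧ ∀ E', IsEllipsoid E' → E' ⊆ C → volume E' ≤ volume E

/-- `E` is an ellipsoid of minimal volume containing `C`. -/
def IsLoewnerEllipsoid {d : ℕ} (C E : Set (Euc d)) : Prop :=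
  IsEllipsoid E ∧ C ⊆ E ∧ ∀ E', IsEllipsoid E' → C ⊆ E' → volume E ≤ volume E'

/-- The point `j(C)`: the center of the John ellipsoid of `C` (which exists and is unique for
every convex body). -/
noncomputable def johnPoint {d : ℕ} (C : Set (Euc d)) : Euc d :=
  Classical.epsilon fun c => ∃ E, IsJohnEllipsoid C E ∧ IsEllipsoidAt E c

/-- The point `l(C)`: the center of the Löwner ellipsoid of `C` (which exists and is unique for
every convex body). -/
noncomputable def loewnerPoint {d : ℕ} (C : Set (Euc d)) : Euc d :=
  Classical.epsilon fun c => ∃ E, IsLoewnerEllipsoid C E ∧ IsEllipsoidAt E c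

open Classical in
/-- The symmetry measure `φ_{p₁,p₂}(C)`: it is `1` if `p₁(C) = p₂(C)`, and otherwise
`1 - ‖p₁(C) - p₂(C)‖ / vol₁(a ∩ C)`, where `a` is the line through `p₁(C)` and `p₂(C)` and
`vol₁` is the length (one-dimensional Hausdorff measure). -/
noncomputable def symMeasure {d : ℕ} (p₁ p₂ : Set (Euc d) → Euc d) (C : Set (Euc d)) : ℝ :=
  if p₁ C = p₂ C then 1
  else 1 - ‖p₁ C - p₂ C‖ /
    (Measure.hausdorffMeasure 1 ((line[ℝ, p₁ C, p₂ C] : Set (Euc d)) ∩ C)).toReal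

/-- `φ_{j,l}`. -/
noncomputable def phiJL {d : ℕ} (C : Set (Euc d)) : ℝ := symMeasure johnPoint loewnerPoint C

/-- The point `(t, x)` of `R^{d+1}`, for `t ∈ R` and `x ∈ R^d`. -/
noncomputable def pairPt {d : ℕ} (t : ℝ) (x : Euc d) : Euc (d + 1) :=
  WithLp.toLp 2 (Fin.cons t x.ofLp)

/-- The number `ε_d`: for `d ≥ 2` the positive solution `ε` of the quadratic equation
`√(1 - 1/d) (1 - (d + 1) ε²) = (d - 1 - 1/d) ε`. -/
noncomputable def epsSeq (d : ℕ) : ℝ :=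
  (√(((d : ℝ) - 1 - 1 / d) ^ 2 + 4 * (d + 1) * (1 - 1 / d)) - ((d : ℝ) - 1 - 1 / d)) /
    (2 * (d + 1) * √(1 - 1 / (d : ℝ)))

/-- The body `C_d ⊆ R^{d+1}`, for a `d`-dimensional simplex `Δ` (to be regular and inscribed in the
unit ball): the convex hull of the union of `(-ε_d, √(1 - ε_d²) Δ)` and
`(√(1 - 1/d), (1/√d) B)`, where `B` is the closed unit ball of `R^d`. -/
noncomputable def bodyC (d : ℕ) (Δ : Affine.Simplex ℝ (Euc d) d) : Set (Euc (d + 1)) :=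
  convexHull ℝ
    ((fun x => pairPt (-epsSeq d) (√(1 - epsSeq d ^ 2) • x)) ''
        convexHull ℝ (range Δ.points) ∪
      (fun x => pairPt √(1 - 1 / (d : ℝ)) ((1 / √(d : ℝ)) • x)) ''
        Metric.closedBall (0 : Euc d) 1)

/-! Lower bound. Call `c` an asymmetry center of `C` if `c - (x - c) / d ∈ C` for all `x ∈ C`. Both
`j(C)` and `l(C)` have this property: the John ellipsoid scaled by `d` contains `C`
(`norm_le_of_john`), and the Löwner ellipsoid scaled by `1/d` lies in `C` (`mem_of_loewner`). Each
is a perturbation argument: if the inclusion failed, an explicit stretched and shifted ellipsoid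
would have a better volume. With `j(C)` at parameter `0` and `l(C)` at `1` on their line, and `C`
cutting out `[a, b]`, the two properties give `b ≤ -d a` and `1 - a ≤ d (b - 1)`. The sum is `d + 1
≤ (b - a)(d - 1)`, and `φ = 1 - 1/(b - a)`.

Upper bound. Write `k = √(1 - 1/d)`. Optimality of an ellipsoid is certified by unit vectors that
decompose the identity and are balanced (`IsJohnDecomposition`): taking traces and applying AM-GM to
singular values settles the volume, and the equality case fixes the center. For `C_d` the unit ball
is Löwner, certified by the bottom vertices and a simplex of top points (`loewner_decomposition`).
The John ellipsoid lies in the frustum of revolution between the inball of the bottom simplex and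
the top ball. Its certificate is a regular simplex of normals: the top facet and the `d + 1` lateral
planes, each through a bottom facet and tangent to the top ball (`johnPoint_bodyC`). Both centers
lie on the axis, whose chord has length at most `k + ε_d`. Hence `φ ≤ (ε_d + α) / (k + ε_d)` with
`α` the vertical semi-axis, and each of the two summands is asymptotically `1/(d + 1)`.

The points `j` and `l` are chosen by `Classical.epsilon`; general uniqueness is never needed, since
the lower bound holds for every optimal ellipsoid and the certificates determine the centers of
`C_d`. -/

/-- The inequality between arithmetic and geometric mean, normalized, with its equality case. -/
theorem prod_le_one_of_sum_le_card {ι : Type*} [Fintype ι] {s : ι → ℝ} (hs : ∀ j, 0 ≤ s j)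
    (hsum : ∑ j, s j ≤ Fintype.card ι) : ∏ j, s j ≤ 1 ∧ (1 ≤ ∏ j, s j → ∀ j, s j = 1) := by
  have hcard : ∑ j, (s j - 1) ≤ 0 := by
    rw [Finset.sum_sub_distrib]; simpa using hsum
  constructor
  · calc ∏ j, s j ≤ ∏ j, Real.exp (s j - 1) :=
          Finset.prod_le_prod (fun j _ => hs j) fun j _ => by
            linarith [Real.add_one_le_exp (s j - 1)]
      _ = Real.exp (∑ j, (s j - 1)) := (Real.exp_sum _ _).symm
      _ ≤ 1 := Real.exp_le_one_iff.2 hcard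
  · intro h
    have hpos : ∀ j, 0 < s j := fun j => (hs j).lt_of_ne' fun h0 => by
      rw [Finset.prod_eq_zero (Finset.mem_univ j) h0] at h; linarith
    have hlog : 0 ≤ ∑ j, Real.log (s j) := by
      rw [← Real.log_prod fun j _ => (hpos j).ne']
      exact Real.log_nonneg h
    have hnn : ∀ j, 0 ≤ s j - 1 - Real.log (s j) := fun j => by
      linarith [Real.log_le_sub_one_of_pos (hpos j)]
    have hz : ∑ j, (s j - 1 - Real.log (s j)) = 0 := by
      refine le_antisymm ?_ (Finset.sum_nonneg fun j _ => hnn j)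
      rw [Finset.sum_sub_distrib]; linarith
    intro j
    by_contra hj
    have := (Finset.sum_eq_zero_iff_of_nonneg fun j _ => hnn j).1 hz j (Finset.mem_univ j)
    linarith [Real.log_lt_sub_one_of_pos (hpos j) hj]

/-! ### Decompositions of the identity as optimality certificates. -/

section JohnDecomposition

variable {E : Type*} [NormedAddCommGroup E] [InnerProductSpace ℝ E]

/-- Unit vectors `u i` with positive weights `c i` that decompose the identity,
`∑ c i • u i ⊗ u i = 1`, and are balanced, `∑ c i • u i = 0`. -/
structure IsJohnDecomposition {ι : Type*} [Fintype ι] (c : ι → ℝ) (u : ι → E) : Prop where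
  pos : ∀ i, 0 < c i
  norm_eq : ∀ i, ‖u i‖ = 1
  sum_smul : ∑ i, c i • u i = 0
  sum_sq : ∀ x, ∑ i, c i * inner ℝ (u i) x ^ 2 = ‖x‖ ^ 2

theorem IsJohnDecomposition.sum_inner {ι : Type*} [Fintype ι] {c : ι → ℝ} {u : ι → E}
    (h : IsJohnDecomposition c u) (x : E) : ∑ i, c i * inner ℝ (u i) x = 0 := by
  have := congrArg (fun y => inner ℝ y x) h.sum_smul
  simpa [_root_.sum_inner, inner_smul_left] using this

variable [FiniteDimensional ℝ E]

theorem LinearMap.det_adjoint_real (T : E →ₗ[ℝ] E) :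
    LinearMap.det (LinearMap.adjoint T) = LinearMap.det T := by
  classical
  have e := stdOrthonormalBasis ℝ E
  rw [← LinearMap.det_toMatrix e.toBasis, ← LinearMap.det_toMatrix e.toBasis,
    LinearMap.toMatrix_adjoint, Matrix.det_conjTranspose]
  simp

/-- The singular values of `T`, with an orthonormal basis of right singular vectors. -/
theorem exists_singular_values (T : E →ₗ[ℝ] E) :
    ∃ (e : OrthonormalBasis (Fin (Module.finrank ℝ E)) ℝ E) (s : Fin (Module.finrank ℝ E) → ℝ),
      (∀ j, 0 ≤ s j) ∧ (∀ x, ‖T x‖ ^ 2 = ∑ j, s j ^ 2 * inner ℝ (e j) x ^ 2) ∧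
        |LinearMap.det T| = ∏ j, s j := by
  have hsym : (LinearMap.adjoint T ∘ₗ T).IsSymmetric := by
    intro x y
    simp [LinearMap.adjoint_inner_left, LinearMap.adjoint_inner_right]
  set e := hsym.eigenvectorBasis rfl with he
  set μ := hsym.eigenvalues rfl with hμ
  have hTe : ∀ j x, inner ℝ (e j) (LinearMap.adjoint T (T x)) = μ j * inner ℝ (e j) x := by
    intro j x
    have h1 := hsym (e j) x
    rw [hsym.apply_eigenvectorBasis rfl j] at h1
    simp only [LinearMap.comp_apply] at h1
    rw [← h1, inner_smul_left]
    simp [hμ, he]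
  have hnn : ∀ j, 0 ≤ μ j := by
    intro j
    have h1 := hTe j (e j)
    rw [LinearMap.adjoint_inner_right, real_inner_self_eq_norm_sq, real_inner_self_eq_norm_sq,
      e.orthonormal.1 j] at h1
    nlinarith [sq_nonneg ‖T (e j)‖]
  refine ⟨e, fun j => √(μ j), fun j => Real.sqrt_nonneg _, fun x => ?_, ?_⟩
  · simp only [Real.sq_sqrt (hnn _)]
    rw [← real_inner_self_eq_norm_sq, ← LinearMap.adjoint_inner_right, ← e.sum_inner_mul_inner]
    refine Finset.sum_congr rfl fun j _ => ?_
    rw [hTe, real_inner_comm]; ring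
  · have hdet : LinearMap.det T ^ 2 = ∏ j, μ j := by
      have h1 := hsym.det_eq_prod_eigenvalues rfl
      rw [LinearMap.det_comp, LinearMap.det_adjoint_real] at h1
      simp only [RCLike.ofReal_real_eq_id, id_eq] at h1
      rw [← h1, sq]
    rw [← Real.sqrt_sq_eq_abs, hdet, Real.sqrt_eq_iff_mul_self_eq]
    · rw [← Finset.prod_mul_distrib]
      exact Finset.prod_congr rfl fun j _ => (Real.mul_self_sqrt (hnn j)).symm
    · exact Finset.prod_nonneg fun j _ => hnn j
    · exact Finset.prod_nonneg fun j _ => Real.sqrt_nonneg _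

namespace IsJohnDecomposition

variable {ι : Type*} [Fintype ι] {c : ι → ℝ} {u : ι → E}

/-- The trace of the identity, computed in an orthonormal basis. -/
theorem sum_weights (h : IsJohnDecomposition c u) : ∑ i, c i = Module.finrank ℝ E := by
  have e := stdOrthonormalBasis ℝ E
  calc ∑ i, c i = ∑ i, ∑ j, c i * inner ℝ (u i) (e j) ^ 2 := by
        refine Finset.sum_congr rfl fun i _ => ?_
        rw [← Finset.mul_sum, e.sum_sq_inner_left, h.norm_eq]; simp
    _ = ∑ j, ∑ i, c i * inner ℝ (u i) (e j) ^ 2 := Finset.sum_comm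
    _ = ∑ j : Fin (Module.finrank ℝ E), (1 : ℝ) := by
        refine Finset.sum_congr rfl fun j _ => ?_
        rw [h.sum_sq, e.orthonormal.1 j]; simp
    _ = _ := by simp

/-- Width estimate: the convex hull of the `u i` contains the ball of radius `1 / n`. -/
theorem norm_le_of_inner_le (h : IsJohnDecomposition c u) {w : E} {M : ℝ}
    (hM : ∀ i, inner ℝ (u i) w ≤ M) : ‖w‖ ≤ Module.finrank ℝ E * M := by
  rcases eq_or_ne w 0 with rfl | hw
  · have h1 : 0 ≤ ∑ i, c i * (M - inner ℝ (u i) (0 : E)) :=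
      Finset.sum_nonneg fun i _ => mul_nonneg (h.pos i).le (sub_nonneg.2 (hM i))
    simp only [inner_zero_right, sub_zero, ← Finset.sum_mul, h.sum_weights] at h1
    simpa using h1
  -- Both factors are nonnegative because `-‖w‖ ≤ ⟪u i, w⟫ ≤ M`; summing the product keeps only the
  -- weights and the second moment.
  · have h1 : 0 ≤ ∑ i, c i * ((M - inner ℝ (u i) w) * (inner ℝ (u i) w + ‖w‖)) := by
      refine Finset.sum_nonneg fun i _ => mul_nonneg (h.pos i).le
        (mul_nonneg (sub_nonneg.2 (hM i)) ?_)
      have := neg_le_of_abs_le (abs_real_inner_le_norm (u i) w)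
      rw [h.norm_eq, one_mul] at this
      linarith
    have h2 : ∑ i, c i * ((M - inner ℝ (u i) w) * (inner ℝ (u i) w + ‖w‖)) =
        M * ‖w‖ * (∑ i, c i) + (M - ‖w‖) * (∑ i, c i * inner ℝ (u i) w) -
          ∑ i, c i * inner ℝ (u i) w ^ 2 := by
      simp only [Finset.mul_sum, ← Finset.sum_add_distrib, ← Finset.sum_sub_distrib]
      exact Finset.sum_congr rfl fun i _ => by ring
    rw [h2, h.sum_inner, h.sum_sq, h.sum_weights] at h1
    have hpos := norm_pos_iff.2 hw
    nlinarith

/-- The unit ball has minimal volume among the ellipsoids `{x | ‖T x + b‖ ≤ 1}` containing the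
`u i`, and any minimizer is centered at the origin. -/
theorem loewner (h : IsJohnDecomposition c u) (T : E →ₗ[ℝ] E) (b : E)
    (hT : ∀ i, ‖T (u i) + b‖ ≤ 1) :
    |LinearMap.det T| ≤ 1 ∧ (1 ≤ |LinearMap.det T| → b = 0) := by
  obtain ⟨e, s, hs, hTs, hdet⟩ := exists_singular_values T
  -- The trace of `T* T`. The cross term with `b` vanishes by balance, so the constraints sum to `∑
  -- s j ^ 2 + n ‖b‖ ^ 2 ≤ n`, with `n` the dimension.
  have htr : ∑ i, c i * ‖T (u i)‖ ^ 2 = ∑ j, s j ^ 2 := by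
    simp only [hTs, Finset.mul_sum]
    rw [Finset.sum_comm]
    refine Finset.sum_congr rfl fun j _ => ?_
    have h1 := h.sum_sq (e j)
    rw [e.orthonormal.1 j, one_pow] at h1
    conv_rhs => rw [← mul_one (s j ^ 2), ← h1, Finset.mul_sum]
    refine Finset.sum_congr rfl fun i _ => ?_
    rw [real_inner_comm]; ring
  have hcross : ∑ i, c i * inner ℝ (T (u i)) b = 0 := by
    have := h.sum_inner (LinearMap.adjoint T b)
    simpa [LinearMap.adjoint_inner_right] using this
  have hle : ∑ i, c i * ‖T (u i) + b‖ ^ 2 ≤ ∑ i, c i := by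
    refine Finset.sum_le_sum fun i _ => ?_
    have : ‖T (u i) + b‖ ^ 2 ≤ 1 := pow_le_one₀ (norm_nonneg _) (hT i)
    nlinarith [h.pos i]
  have hexp : ∑ i, c i * ‖T (u i) + b‖ ^ 2 =
      ∑ i, c i * ‖T (u i)‖ ^ 2 + 2 * (∑ i, c i * inner ℝ (T (u i)) b) +
        ‖b‖ ^ 2 * ∑ i, c i := by
    simp only [Finset.mul_sum, ← Finset.sum_add_distrib, norm_add_sq_real]
    exact Finset.sum_congr rfl fun i _ => by ring
  rw [hexp, htr, hcross, h.sum_weights] at hle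
  have hsum : ∑ j, s j ^ 2 ≤ Fintype.card (Fin (Module.finrank ℝ E)) := by
    rw [Fintype.card_fin]
    nlinarith [mul_nonneg (sq_nonneg ‖b‖) (Nat.cast_nonneg (α := ℝ) (Module.finrank ℝ E))]
  obtain ⟨h1, h2⟩ := prod_le_one_of_sum_le_card (fun j => sq_nonneg (s j)) hsum
  rw [Finset.prod_pow, ← hdet] at h1 h2
  refine ⟨(sq_le_one_iff₀ (abs_nonneg _)).1 h1, fun hge => ?_⟩
  have hall := h2 (one_le_pow₀ hge)
  by_contra hb
  have hfr : 0 < Module.finrank ℝ E := by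
    have : Nontrivial E := ⟨⟨b, 0, hb⟩⟩
    exact Module.finrank_pos
  simp only [hall, Finset.sum_const, Finset.card_univ, Fintype.card_fin, nsmul_eq_mul,
    mul_one] at hle
  have hb' : 0 < ‖b‖ ^ 2 := by positivity
  have : (0 : ℝ) < Module.finrank ℝ E := by exact_mod_cast hfr
  nlinarith [mul_pos hb' this]

/-- The unit ball has maximal volume among the ellipsoids `A B + b` contained in the polytope
`{x | ∀ i, ⟪u i, x⟫ ≤ 1}`, and any maximizer is centered at the origin. -/
theorem john (h : IsJohnDecomposition c u) (A : E →ₗ[ℝ] E) (b : E)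
    (hA : ∀ i, ∀ x, ‖x‖ ≤ 1 → inner ℝ (u i) (A x + b) ≤ 1) :
    |LinearMap.det A| ≤ 1 ∧ (1 ≤ |LinearMap.det A| → b = 0) := by
  obtain ⟨e, s, hs, hTs, hdet⟩ := exists_singular_values (LinearMap.adjoint A)
  have hdet' : |LinearMap.det A| = ∏ j, s j := by
    rw [← hdet, LinearMap.det_adjoint_real]
  -- The constraint evaluated at the support point of the ellipsoid in direction `u i`.
  have hsupp : ∀ i, ‖LinearMap.adjoint A (u i)‖ + inner ℝ (u i) b ≤ 1 := by
    intro i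
    set y := LinearMap.adjoint A (u i) with hy
    have h1 := hA i (‖y‖⁻¹ • y) (by
      rw [norm_smul, norm_inv, norm_norm]; exact inv_mul_le_one)
    rw [inner_add_right, ← LinearMap.adjoint_inner_left, ← hy, inner_smul_right,
      real_inner_self_eq_norm_sq] at h1
    rcases eq_or_ne ‖y‖ 0 with h0 | h0
    · rw [h0] at h1 ⊢; simpa using h1
    · rwa [sq, inv_mul_cancel_left₀ h0] at h1
  -- Cauchy-Schwarz gives `⟪u, |A*| u⟫ ≤ ‖A* u‖`, which makes the constraint linear in the singular
  -- values.
  have hlow : ∀ i, ∑ j, s j * inner ℝ (e j) (u i) ^ 2 ≤ ‖LinearMap.adjoint A (u i)‖ := by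
    intro i
    have hu : ∑ j, inner ℝ (e j) (u i) ^ 2 = 1 := by
      rw [e.sum_sq_inner_right, h.norm_eq]; simp
    refine le_of_sq_le_sq ?_ (norm_nonneg _)
    have hcs := Finset.sum_mul_sq_le_sq_mul_sq Finset.univ
      (fun j => s j * inner ℝ (e j) (u i)) (fun j => inner ℝ (e j) (u i))
    rw [hu, mul_one] at hcs
    rw [hTs]
    refine le_trans (le_of_eq ?_) (hcs.trans (le_of_eq ?_))
    · congr 1; exact Finset.sum_congr rfl fun j _ => by ring
    · exact Finset.sum_congr rfl fun j _ => by ring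
  have htr : ∑ i, c i * ∑ j, s j * inner ℝ (e j) (u i) ^ 2 = ∑ j, s j := by
    simp only [Finset.mul_sum]
    rw [Finset.sum_comm]
    refine Finset.sum_congr rfl fun j _ => ?_
    have h1 := h.sum_sq (e j)
    rw [e.orthonormal.1 j, one_pow] at h1
    conv_rhs => rw [← mul_one (s j), ← h1, Finset.mul_sum]
    refine Finset.sum_congr rfl fun i _ => ?_
    rw [real_inner_comm]; ring
  have hsum : ∑ j, s j ≤ Fintype.card (Fin (Module.finrank ℝ E)) := by
    rw [Fintype.card_fin, ← htr, ← h.sum_weights]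
    calc _ ≤ ∑ i, (c i - c i * inner ℝ (u i) b) := Finset.sum_le_sum fun i _ => by
            nlinarith [h.pos i, hlow i, hsupp i]
      _ = _ := by rw [Finset.sum_sub_distrib, h.sum_inner, sub_zero]
  obtain ⟨h1, h2⟩ := prod_le_one_of_sum_le_card hs hsum
  rw [← hdet'] at h1 h2
  refine ⟨h1, fun hge => ?_⟩
  have hall := h2 hge
  -- With all singular values `1` the support constraint reads `⟪u i, b⟫ ≤ 0`; balance turns these
  -- into equalities.
  have hnonneg : ∀ i, 0 ≤ -(c i * inner ℝ (u i) b) := by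
    intro i
    have h3 := hTs (u i)
    simp only [hall, one_pow, one_mul, e.sum_sq_inner_right, h.norm_eq] at h3
    have h4 : ‖LinearMap.adjoint A (u i)‖ = 1 := by
      exact (pow_eq_one_iff_of_nonneg (norm_nonneg _) two_ne_zero).1 h3
    have h5 := hsupp i
    nlinarith [h.pos i]
  have hzero : ∑ i, -(c i * inner ℝ (u i) b) = 0 := by
    rw [Finset.sum_neg_distrib, h.sum_inner, neg_zero]
  have hall0 := (Finset.sum_eq_zero_iff_of_nonneg fun i _ => hnonneg i).1 hzero
  have hb : ‖b‖ ^ 2 = 0 := by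
    rw [← h.sum_sq b]
    refine Finset.sum_eq_zero fun i _ => ?_
    rw [sq, ← mul_assoc, neg_eq_zero.1 (hall0 i (Finset.mem_univ i)), zero_mul]
  simpa using hb

end IsJohnDecomposition

end JohnDecomposition

/-! ### Membership in closed convex sets through support functions. -/

section Separation

variable {E : Type*} [NormedAddCommGroup E] [InnerProductSpace ℝ E] [CompleteSpace E]

theorem mem_of_forall_inner_le {C : Set E} (hC : Convex ℝ C) (hcl : IsClosed C) {y : E}
    (h : ∀ w u, (∀ x ∈ C, inner ℝ w x ≤ u) → inner ℝ w y ≤ u) : y ∈ C := by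
  by_contra hy
  obtain ⟨f, u, hf, hu⟩ := geometric_hahn_banach_closed_point hC hcl hy
  have := h ((InnerProductSpace.toDual ℝ E).symm f) u fun x hx => by
    simpa using (hf x hx).le
  simp only [InnerProductSpace.toDual_symm_apply] at this
  linarith

end Separation

/-! ### Stretches along one direction. -/

section AxialStretch

variable {E : Type*} [NormedAddCommGroup E] [InnerProductSpace ℝ E]

/-- The stretch by the factor `ρ` in the direction of the unit vector `e`. -/
noncomputable def axialStretch (e : E) (ρ : ℝ) : E →ₗ[ℝ] E :=
  LinearMap.transvection (innerSL ℝ e : E →ₗ[ℝ] ℝ) ((ρ - 1) • e)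

theorem axialStretch_apply (e : E) (ρ : ℝ) (x : E) :
    axialStretch e ρ x = x + ((ρ - 1) * inner ℝ e x) • e := by
  simp [axialStretch, LinearMap.transvection.apply, smul_smul, mul_comm]

theorem det_axialStretch [FiniteDimensional ℝ E] {e : E} (he : ‖e‖ = 1) (ρ : ℝ) :
    LinearMap.det (axialStretch e ρ) = ρ := by
  rw [axialStretch, LinearMap.transvection.det]
  simp [he]

theorem inner_axialStretch (e : E) (ρ : ℝ) (w x : E) :
    inner ℝ w (axialStretch e ρ x) = inner ℝ (axialStretch e ρ w) x := by
  simp only [axialStretch_apply, inner_add_left, inner_add_right, inner_smul_left,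
    inner_smul_right, RCLike.conj_to_real]
  rw [real_inner_comm w e]; ring

theorem norm_axialStretch_sq {e : E} (he : ‖e‖ = 1) (ρ : ℝ) (x : E) :
    ‖axialStretch e ρ x‖ ^ 2 = ‖x‖ ^ 2 + (ρ ^ 2 - 1) * inner ℝ e x ^ 2 := by
  rw [axialStretch_apply, norm_add_sq_real, norm_smul, he, inner_smul_right, real_inner_comm,
    mul_one, Real.norm_eq_abs, sq_abs]
  ring

end AxialStretch

/-! ### Existence of extremal ellipsoids and the meaning of the two chosen centers. -/

section Existence

variable {d : ℕ}

theorem volume_ellipsoid (A : Euc d →ₗ[ℝ] Euc d) (c : Euc d) :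
    volume ((fun x => A x + c) '' Metric.closedBall (0 : Euc d) 1) =
      ENNReal.ofReal |LinearMap.det A| * volume (Metric.closedBall (0 : Euc d) 1) := by
  have : (fun x => A x + c) '' Metric.closedBall (0 : Euc d) 1 =
      (fun y => y + c) '' (A '' Metric.closedBall (0 : Euc d) 1) := by
    rw [image_image]
  rw [this, image_add_right, measure_preimage_add_right, Measure.addHaar_image_linearMap]

theorem volume_ellipsoid_le_iff (A A' : Euc d →ₗ[ℝ] Euc d) (c c' : Euc d) :
    volume ((fun x => A x + c) '' Metric.closedBall (0 : Euc d) 1) ≤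
      volume ((fun x => A' x + c') '' Metric.closedBall (0 : Euc d) 1) ↔
      |LinearMap.det A| ≤ |LinearMap.det A'| := by
  have h0 : volume (Metric.closedBall (0 : Euc d) 1) ≠ 0 :=
    (Metric.measure_closedBall_pos _ _ one_pos).ne'
  have h1 : volume (Metric.closedBall (0 : Euc d) 1) ≠ ⊤ := measure_closedBall_lt_top.ne
  rw [volume_ellipsoid, volume_ellipsoid, ENNReal.mul_le_mul_iff_left h0 h1,
    ENNReal.ofReal_le_ofReal_iff (abs_nonneg _)]

theorem exists_forall_abs_det_le {d : ℕ} {K : Set ((Euc d →L[ℝ] Euc d) × Euc d)}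
    (hcl : IsClosed K) (hne : K.Nonempty) {M N : ℝ} (hM : ∀ p ∈ K, ‖p.1‖ ≤ M)
    (hN : ∀ p ∈ K, ‖p.2‖ ≤ N) : ∃ p ∈ K, ∀ q ∈ K, |q.1.det| ≤ |p.1.det| := by
  have hK : IsCompact K := by
    refine Metric.isCompact_of_isClosed_isBounded hcl
      ((isBounded_iff_forall_norm_le).2 ⟨max M N, fun p hp => ?_⟩)
    rw [Prod.norm_def]
    exact max_le_max (hM p hp) (hN p hp)
  exact hK.exists_isMaxOn hne
    ((ContinuousLinearMap.continuous_det.comp continuous_fst).abs.continuousOn)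

/-- Compactness of the set of pairs (linear map, center). Singular maps are admitted, which keeps
this set closed; a small ball in `C` shows that the maximizer is invertible. -/
theorem exists_max_ellipsoid {C : Set (Euc d)} (hC : C ∈ convexBodies d) :
    ∃ (A : Euc d ≃ₗ[ℝ] Euc d) (c : Euc d), (∀ x, ‖x‖ ≤ 1 → A x + c ∈ C) ∧
      ∀ (A' : Euc d →ₗ[ℝ] Euc d) (c' : Euc d), (∀ x, ‖x‖ ≤ 1 → A' x + c' ∈ C) →
        |LinearMap.det A'| ≤ |LinearMap.det (A : Euc d →ₗ[ℝ] Euc d)| := by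
  obtain ⟨-, hcomp, x₀, hx₀⟩ := hC
  obtain ⟨r, hr, hball⟩ := Metric.nhds_basis_closedBall.mem_iff.1 (mem_interior_iff_mem_nhds.1 hx₀)
  obtain ⟨M, hM⟩ := isBounded_iff_forall_norm_le.1 hcomp.isBounded
  set K : Set ((Euc d →L[ℝ] Euc d) × Euc d) := {p | ∀ x, ‖x‖ ≤ 1 → p.1 x + p.2 ∈ C} with hKdef
  have hmem : ((r • ContinuousLinearMap.id ℝ (Euc d), x₀) : _ × Euc d) ∈ K := fun x hx => by
    refine hball ?_
    rw [Metric.mem_closedBall, dist_eq_norm]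
    simp only [_root_.smul_apply, ContinuousLinearMap.id_apply, add_sub_cancel_right,
      norm_smul, Real.norm_eq_abs, abs_of_pos hr]
    nlinarith
  have hcl : IsClosed K := by
    simp only [hKdef, ofPred_forall]
    refine isClosed_iInter fun x => isClosed_iInter fun _ => hcomp.isClosed.preimage ?_
    fun_prop
  have hN : ∀ p ∈ K, ‖p.2‖ ≤ M := fun p hp => by simpa using hM _ (hp 0 (by simp))
  have hM' : ∀ p ∈ K, ‖p.1‖ ≤ M + M := fun p hp => by
    have h0 := hN p hp
    refine ContinuousLinearMap.opNorm_le_of_unit_norm (by linarith [norm_nonneg p.2]) fun x hx => ?_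
    calc ‖p.1 x‖ = ‖(p.1 x + p.2) - p.2‖ := by rw [add_sub_cancel_right]
      _ ≤ M + M := (norm_sub_le _ _).trans (add_le_add (hM _ (hp x hx.le)) h0)
  obtain ⟨p, hp, hmax⟩ := exists_forall_abs_det_le hcl ⟨_, hmem⟩ hM' hN
  have hdet : LinearMap.det (p.1 : Euc d →ₗ[ℝ] Euc d) ≠ 0 := by
    have h1 := hmax _ hmem
    have h2 : (r • ContinuousLinearMap.id ℝ (Euc d)).det = r ^ d := by
      simp [ContinuousLinearMap.det, LinearMap.det_smul]
    rw [h2] at h1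
    exact abs_pos.1 (lt_of_lt_of_le (by positivity) h1)
  refine ⟨LinearMap.equivOfDetNeZero (p.1 : Euc d →ₗ[ℝ] Euc d) hdet, p.2, fun x hx => hp x hx,
    fun A' c' h => ?_⟩
  exact hmax (LinearMap.toContinuousLinearMap A', c') h

theorem johnPoint_spec {C : Set (Euc d)} (hC : C ∈ convexBodies d) :
    ∃ A : Euc d ≃ₗ[ℝ] Euc d, (∀ x, ‖x‖ ≤ 1 → A x + johnPoint C ∈ C) ∧
      ∀ (A' : Euc d →ₗ[ℝ] Euc d) (c' : Euc d), (∀ x, ‖x‖ ≤ 1 → A' x + c' ∈ C) →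
        |LinearMap.det A'| ≤ |LinearMap.det (A : Euc d →ₗ[ℝ] Euc d)| := by
  obtain ⟨A, c, hAc, hmax⟩ := exists_max_ellipsoid hC
  have hex : ∃ c, ∃ E, IsJohnEllipsoid C E ∧ IsEllipsoidAt E c := by
    refine ⟨c, _, ⟨⟨c, A, rfl⟩, ?_, ?_⟩, A, rfl⟩
    · rintro _ ⟨x, hx, rfl⟩
      exact hAc x (by simpa using hx)
    · rintro _ ⟨c', A', rfl⟩ h
      refine (volume_ellipsoid_le_iff (A' : Euc d →ₗ[ℝ] Euc d) A c' c).2 (hmax A' c' fun x hx => ?_)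
      exact h ⟨x, by simpa using hx, rfl⟩
  obtain ⟨E, ⟨-, hE, hEmax⟩, B, rfl⟩ := Classical.epsilon_spec hex
  refine ⟨B, fun x hx => hE ⟨x, by simpa using hx, rfl⟩, fun A' c' h => (hmax A' c' h).trans ?_⟩
  refine (volume_ellipsoid_le_iff (A : Euc d →ₗ[ℝ] Euc d) B c _).1 (hEmax _ ⟨c, A, rfl⟩ ?_)
  rintro _ ⟨x, hx, rfl⟩
  exact hAc x (by simpa using hx)

/-- An ellipsoid is written as `{x | ‖T x + b‖ ≤ 1}`, so minimal volume means maximal `|det T|`. A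
ball inside `C` bounds `T`, and boundedness of `C` supplies a competitor with nonzero determinant.
-/
theorem exists_min_ellipsoid {C : Set (Euc d)} (hC : C ∈ convexBodies d) :
    ∃ (A : Euc d ≃ₗ[ℝ] Euc d) (c : Euc d), (∀ x ∈ C, ‖A.symm (x - c)‖ ≤ 1) ∧
      ∀ (T : Euc d →ₗ[ℝ] Euc d) (b : Euc d), (∀ x ∈ C, ‖T x + b‖ ≤ 1) →
        |LinearMap.det T| ≤ |LinearMap.det (A.symm : Euc d →ₗ[ℝ] Euc d)| := by
  obtain ⟨-, hcomp, x₀, hx₀⟩ := hC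
  obtain ⟨r, hr, hball⟩ := Metric.nhds_basis_closedBall.mem_iff.1 (mem_interior_iff_mem_nhds.1 hx₀)
  obtain ⟨M, hMpos, hM⟩ := hcomp.isBounded.exists_pos_norm_le
  set K : Set ((Euc d →L[ℝ] Euc d) × Euc d) := {p | ∀ x ∈ C, ‖p.1 x + p.2‖ ≤ 1} with hKdef
  have hmem : ((M⁻¹ • ContinuousLinearMap.id ℝ (Euc d), 0) : _ × Euc d) ∈ K := fun x hx => by
    simp only [_root_.smul_apply, ContinuousLinearMap.id_apply, add_zero,
      norm_smul, norm_inv, Real.norm_eq_abs, abs_of_pos hMpos]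
    exact inv_mul_le_one_of_le₀ (hM x hx) hMpos.le
  have hcl : IsClosed K := by
    simp only [hKdef, ofPred_forall]
    refine isClosed_iInter fun x => isClosed_iInter fun _ => isClosed_le ?_ continuous_const
    fun_prop
  have hM' : ∀ p ∈ K, ‖p.1‖ ≤ 2 / r := fun p hp => by
    refine ContinuousLinearMap.opNorm_le_of_unit_norm (by positivity) fun x hx => ?_
    have h1 := hp x₀ (hball (Metric.mem_closedBall_self hr.le))
    have h2 := hp (x₀ + r • x) (hball (by simp [norm_smul, hx, abs_of_pos hr]))
    have h3 : ‖r • p.1 x‖ ≤ 2 := by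
      calc ‖r • p.1 x‖ = ‖(p.1 (x₀ + r • x) + p.2) - (p.1 x₀ + p.2)‖ := by
            rw [map_add, map_smul]; congr 1; abel
        _ ≤ 1 + 1 := (norm_sub_le _ _).trans (add_le_add h2 h1)
        _ = 2 := by norm_num
    rw [norm_smul, Real.norm_eq_abs, abs_of_pos hr] at h3
    rw [le_div_iff₀ hr]; linarith
  have hN : ∀ p ∈ K, ‖p.2‖ ≤ 1 + 2 / r * ‖x₀‖ := fun p hp => by
    have h1 := hp x₀ (hball (Metric.mem_closedBall_self hr.le))
    calc ‖p.2‖ = ‖(p.1 x₀ + p.2) - p.1 x₀‖ := by rw [add_sub_cancel_left]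
      _ ≤ 1 + 2 / r * ‖x₀‖ := (norm_sub_le _ _).trans
        (add_le_add h1 (p.1.le_of_opNorm_le (hM' p hp) x₀))
  obtain ⟨p, hp, hmax⟩ := exists_forall_abs_det_le hcl ⟨_, hmem⟩ hM' hN
  have hdet : LinearMap.det (p.1 : Euc d →ₗ[ℝ] Euc d) ≠ 0 := by
    have h1 := hmax _ hmem
    have h2 : (M⁻¹ • ContinuousLinearMap.id ℝ (Euc d)).det = M⁻¹ ^ d := by
      simp [ContinuousLinearMap.det, LinearMap.det_smul]
    rw [h2] at h1
    exact abs_pos.1 (lt_of_lt_of_le (by positivity) h1)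
  set T := LinearMap.equivOfDetNeZero (p.1 : Euc d →ₗ[ℝ] Euc d) hdet with hT
  have hTapp : ∀ x, T x = p.1 x := fun x => rfl
  refine ⟨T.symm, -T.symm p.2, fun x hx => ?_, fun A' c' h => ?_⟩
  · rw [LinearEquiv.symm_symm, sub_neg_eq_add, map_add, LinearEquiv.apply_symm_apply, hTapp]
    exact hp x hx
  · exact hmax (LinearMap.toContinuousLinearMap A', c') h

theorem subset_ellipsoid_iff (A : Euc d ≃ₗ[ℝ] Euc d) (c : Euc d) (C : Set (Euc d)) :
    C ⊆ (fun x => A x + c) '' Metric.closedBall (0 : Euc d) 1 ↔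
      ∀ x ∈ C, ‖A.symm (x - c)‖ ≤ 1 := by
  refine forall₂_congr fun x _ => ⟨?_, fun h => ⟨A.symm (x - c), by simpa using h, by simp⟩⟩
  rintro ⟨y, hy, rfl⟩
  simpa using hy

theorem abs_det_le_iff_abs_det_symm_le (A A' : Euc d ≃ₗ[ℝ] Euc d) :
    |LinearMap.det (A : Euc d →ₗ[ℝ] Euc d)| ≤ |LinearMap.det (A' : Euc d →ₗ[ℝ] Euc d)| ↔
      |LinearMap.det (A'.symm : Euc d →ₗ[ℝ] Euc d)| ≤
        |LinearMap.det (A.symm : Euc d →ₗ[ℝ] Euc d)| := by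
  have h1 : ∀ B : Euc d ≃ₗ[ℝ] Euc d, |LinearMap.det (B.symm : Euc d →ₗ[ℝ] Euc d)| =
      |LinearMap.det (B : Euc d →ₗ[ℝ] Euc d)|⁻¹ := fun B => by
    rw [← abs_inv, eq_inv_of_mul_eq_one_left (LinearEquiv.det_symm_mul_det B)]
  have h2 : ∀ B : Euc d ≃ₗ[ℝ] Euc d, 0 < |LinearMap.det (B : Euc d →ₗ[ℝ] Euc d)| := fun B =>
    abs_pos.2 B.isUnit_det'.ne_zero
  rw [h1, h1, inv_le_inv₀ (h2 _) (h2 _)]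

theorem loewnerPoint_spec {C : Set (Euc d)} (hC : C ∈ convexBodies d) :
    ∃ A : Euc d ≃ₗ[ℝ] Euc d, (∀ x ∈ C, ‖A.symm (x - loewnerPoint C)‖ ≤ 1) ∧
      ∀ (T : Euc d →ₗ[ℝ] Euc d) (b : Euc d), (∀ x ∈ C, ‖T x + b‖ ≤ 1) →
        |LinearMap.det T| ≤ |LinearMap.det (A.symm : Euc d →ₗ[ℝ] Euc d)| := by
  obtain ⟨A, c, hAc, hmax⟩ := exists_min_ellipsoid hC
  have hex : ∃ c, ∃ E, IsLoewnerEllipsoid C E ∧ IsEllipsoidAt E c := by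
    refine ⟨c, _, ⟨⟨c, A, rfl⟩, (subset_ellipsoid_iff A c C).2 hAc, ?_⟩, A, rfl⟩
    rintro _ ⟨c', A', rfl⟩ h
    refine (volume_ellipsoid_le_iff (A : Euc d →ₗ[ℝ] Euc d) A' c c').2
      ((abs_det_le_iff_abs_det_symm_le A A').2 (hmax A'.symm (-A'.symm c') fun x hx => ?_))
    simpa [sub_eq_add_neg] using (subset_ellipsoid_iff A' c' C).1 h x hx
  obtain ⟨E, ⟨-, hE, hEmin⟩, B, rfl⟩ := Classical.epsilon_spec hex
  refine ⟨B, (subset_ellipsoid_iff B _ C).1 hE, fun T b h => (hmax T b h).trans ?_⟩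
  refine (abs_det_le_iff_abs_det_symm_le B A).1
    ((volume_ellipsoid_le_iff (B : Euc d →ₗ[ℝ] Euc d) A _ c).1
      (hEmin _ ⟨c, A, rfl⟩ ((subset_ellipsoid_iff A c C).2 hAc)))

end Existence

/-! ### John and Löwner centers are asymmetry centers. -/

section Asymmetry

theorem abs_det_comp_smul_axialStretch {E : Type*} [NormedAddCommGroup E]
    [InnerProductSpace ℝ E] [FiniteDimensional ℝ E] (A : E →ₗ[ℝ] E) {e : E} (he : ‖e‖ = 1)
    (β ρ : ℝ) :
    |LinearMap.det (A ∘ₗ (β • axialStretch e ρ))| =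
      |LinearMap.det A| * |β ^ Module.finrank ℝ E * ρ| := by
  rw [LinearMap.det_comp, LinearMap.det_smul, det_axialStretch he, abs_mul]

/-- Support function estimate: an ellipsoid inscribed in the convex hull of the unit ball and a
point at distance `s` from its center. -/
theorem support_spheroid_le {s t p q u : ℝ} (hs : 1 < s) (ht0 : 0 < t) (ht1 : t ≤ 1)
    (hts : 0 < 1 - 2 * t / (s - 1)) (hpq : |p| ≤ q) (hq : q ≤ u) (hsp : s * p ≤ u) :
    t * p + √((1 - 2 * t / (s - 1)) * q ^ 2 + ((1 + t) ^ 2 - (1 - 2 * t / (s - 1))) * p ^ 2) ≤ u := by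
  have hp := abs_le.1 hpq
  have hq0 : 0 ≤ q := (abs_nonneg p).trans hpq
  have hs1 : 0 < s - 1 := by linarith
  -- It suffices to treat `v = max q (s * p)`, the support function of the hull. With `x = 2 t / (s
  -- - 1)` the defect is `x (q - s p)(q + p)` or `(1 - x)((s p)² - q²)` in the two cases.
  have hkey : ∀ v, q ≤ v → s * p ≤ v → (v = q ∨ v = s * p) → t * p +
      √((1 - 2 * t / (s - 1)) * q ^ 2 + ((1 + t) ^ 2 - (1 - 2 * t / (s - 1))) * p ^ 2) ≤ v := by
    intro v hqv hspv hv
    rw [← le_sub_iff_add_le']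
    refine Real.sqrt_le_iff.2 ⟨by nlinarith, ?_⟩
    rw [← sub_nonneg]
    have e1 : 2 * t / (s - 1) * (s - 1) = 2 * t := by field_simp
    set x := 2 * t / (s - 1) with hx
    have hx0 : 0 ≤ x := by positivity
    have e2 : 2 * t = x * (s - 1) := e1.symm
    have e3 : (v - t * p) ^ 2 - ((1 - x) * q ^ 2 + ((1 + t) ^ 2 - (1 - x)) * p ^ 2) =
        (v ^ 2 - q ^ 2) + x * q ^ 2 - x * (s - 1) * (v * p) - x * s * p ^ 2 := by
      linear_combination (-(v * p) - p ^ 2) * e2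
    rw [e3]
    rcases hv with rfl | rfl
    · have := mul_nonneg hx0 (mul_nonneg (sub_nonneg.2 hspv) (by linarith : 0 ≤ v + p))
      nlinarith
    · have h2 : q ^ 2 ≤ (s * p) ^ 2 := by gcongr
      nlinarith [mul_nonneg hts.le (sub_nonneg.2 h2)]
  rcases le_total q (s * p) with h | h
  · exact (hkey _ h le_rfl (Or.inr rfl)).trans hsp
  · exact (hkey _ le_rfl h (Or.inl rfl)).trans hq

/-- To first order in `t` the product is `1 + 2 t (1 - κ)` with `κ = (d - 1)/(s - 1) < 1`.
Bernoulli's inequality makes this quantitative at `t = (1 - κ)/4`. -/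
theorem exists_stretch_john {d : ℕ} (hd : 2 ≤ d) {s : ℝ} (hs : (d : ℝ) < s) :
    ∃ t : ℝ, 0 < t ∧ t ≤ 1 ∧ 0 < 1 - 2 * t / (s - 1) ∧
      1 < (1 + t) ^ 2 * (1 - 2 * t / (s - 1)) ^ (d - 1) := by
  have hd' : (2 : ℝ) ≤ d := by exact_mod_cast hd
  have hs1 : 0 < s - 1 := by linarith
  set κ := ((d : ℝ) - 1) / (s - 1) with hκ
  have hκ1 : κ < 1 := by rw [hκ, div_lt_one hs1]; linarith
  have hκ0 : 0 < κ := by rw [hκ]; apply div_pos <;> linarith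
  have hx : 2 * ((1 - κ) / 4) / (s - 1) ≤ 1 / 2 := by
    rw [div_le_iff₀ hs1]; nlinarith
  refine ⟨(1 - κ) / 4, by linarith, by linarith, by linarith, ?_⟩
  have hb := one_add_mul_le_pow (a := -(2 * ((1 - κ) / 4) / (s - 1))) (by linarith) (d - 1)
  rw [Nat.cast_sub (by lia), Nat.cast_one] at hb
  have h1 : ((d : ℝ) - 1) * -(2 * ((1 - κ) / 4) / (s - 1)) = - (κ * ((1 - κ) / 2)) := by
    rw [hκ]; field_simp; ring
  rw [h1, ← sub_eq_add_neg, ← sub_eq_add_neg] at hb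
  have h2 : (1 + (1 - κ) / 4) ^ 2 * (1 - κ * ((1 - κ) / 2)) ≤ _ :=
    mul_le_mul_of_nonneg_left hb (sq_nonneg (1 + (1 - κ) / 4))
  refine lt_of_lt_of_le ?_ h2
  have h3 : (1 + (1 - κ) / 2) * (1 - κ * ((1 - κ) / 2)) ≤
      (1 + (1 - κ) / 4) ^ 2 * (1 - κ * ((1 - κ) / 2)) :=
    mul_le_mul_of_nonneg_right (by nlinarith) (by nlinarith)
  refine lt_of_lt_of_le ?_ h3
  nlinarith [mul_pos (sub_pos.2 hκ1) (sub_pos.2 hκ1), mul_pos hκ0 (sub_pos.2 hκ1),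
    mul_pos (mul_pos (sub_pos.2 hκ1) (sub_pos.2 hκ1)) (sub_pos.2 hκ1)]

/-- To first order this compares `d τ l` with `l`. The power is bounded above by applying Bernoulli
to `(1 - x) ^ d` and using `(1 + x)(1 - x) ≤ 1`. -/
theorem exists_stretch_loewner {d : ℕ} (hd : 1 ≤ d) {τ : ℝ} (hτ0 : 0 ≤ τ) (hτ : d * τ < 1) :
    ∃ l : ℝ, 0 < l ∧ (1 + l * τ + l ^ 2) ^ d < 1 + l := by
  have hd' : (1 : ℝ) ≤ d := by exact_mod_cast hd
  have hd0 : (0 : ℝ) < d := by linarith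
  set h := 1 - d * τ with hh
  have hh0 : 0 < h := by linarith
  have hh1 : h ≤ 1 := by have := mul_nonneg hd0.le hτ0; linarith
  set l := h / (4 * d) with hl
  have hl0 : 0 < l := by positivity
  have hdl : d * l = h / 4 := by rw [hl]; field_simp
  have hl1 : l ≤ h / 4 := by nlinarith
  refine ⟨l, hl0, ?_⟩
  set x := l * τ + l ^ 2 with hx
  have hx0 : 0 ≤ x := by positivity
  have hdx : d * x = l * (1 - h + h / 4) := by
    rw [hx, ← hdl, hh]; ring
  have hx1 : x ≤ 1 := by nlinarith
  have hb := one_add_mul_le_pow (a := -x) (by linarith) d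
  have hprod : (1 + x) ^ d * (1 + -x) ^ d ≤ 1 := by
    rw [← mul_pow]
    exact pow_le_one₀ (mul_nonneg (by linarith) (by linarith)) (by nlinarith)
  have hpos : 0 < (1 + x) ^ d := by positivity
  have h1 : (1 + x) ^ d * (1 - l * (1 - h + h / 4)) ≤ 1 := by
    refine le_trans (mul_le_mul_of_nonneg_left ?_ hpos.le) hprod
    rw [← hdx]; linarith
  have h2 : 1 < (1 + l) * (1 - l * (1 - h + h / 4)) := by
    have : (1 + l) * (1 - h + h / 4) < 1 := by nlinarith
    nlinarith
  rw [add_assoc, ← hx]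
  have h3 : 0 < 1 - l * (1 - h + h / 4) := by nlinarith
  nlinarith

variable {d : ℕ}

/-- The John ellipsoid, scaled by `d` about its center, contains the body. -/
theorem norm_le_of_john (hd : 2 ≤ d) {C : Set (Euc d)} (hC : Convex ℝ C) (hcl : IsClosed C)
    {A : Euc d ≃ₗ[ℝ] Euc d} {c : Euc d} (hA : ∀ x, ‖x‖ ≤ 1 → A x + c ∈ C)
    (hmax : ∀ (A' : Euc d →ₗ[ℝ] Euc d) (c' : Euc d), (∀ x, ‖x‖ ≤ 1 → A' x + c' ∈ C) →
      |LinearMap.det A'| ≤ |LinearMap.det (A : Euc d →ₗ[ℝ] Euc d)|) {y : Euc d}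
    (hy : A y + c ∈ C) : ‖y‖ ≤ d := by
  by_contra! hs
  set s := ‖y‖ with hsdef
  have hd' : (2 : ℝ) ≤ d := by exact_mod_cast hd
  have hs0 : 0 < s := by linarith
  obtain ⟨t, ht0, ht1, hβ, hdet⟩ := exists_stretch_john hd hs
  set e := s⁻¹ • y with he
  have he1 : ‖e‖ = 1 := by
    rw [he, norm_smul, norm_inv, Real.norm_eq_abs, abs_of_pos hs0, ← hsdef,
      inv_mul_cancel₀ hs0.ne']
  have hye : y = s • e := by rw [he, smul_inv_smul₀ hs0.ne']
  set b := 1 - 2 * t / (s - 1) with hb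
  set β := √b with hβdef
  have hβ0 : 0 < β := Real.sqrt_pos.2 hβ
  have hβ2 : β ^ 2 = b := Real.sq_sqrt hβ.le
  -- Semi-axis `1 + t` along `e` and `β` across it; the competitor is this spheroid shifted by `t •
  -- e`.
  set D := β • axialStretch e ((1 + t) / β) with hD
  have hnorm : ∀ w, ‖D w‖ = √(b * ‖w‖ ^ 2 + ((1 + t) ^ 2 - b) * inner ℝ e w ^ 2) := by
    intro w
    rw [← Real.sqrt_sq (norm_nonneg (D w)), hD, LinearMap.smul_apply, norm_smul, mul_pow,
      norm_axialStretch_sq he1, Real.norm_eq_abs, sq_abs, div_pow, hβ2]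
    congr 1
    field_simp
  have hmem : ∀ x, ‖x‖ ≤ 1 → (A : Euc d →ₗ[ℝ] Euc d) (D x) + (A (t • e) + c) ∈ C := by
    intro x hx
    have hcont : Continuous (A : Euc d → Euc d) :=
      (A : Euc d →ₗ[ℝ] Euc d).continuous_of_finiteDimensional
    have hx' : D x + t • e ∈ (fun z => A z + c) ⁻¹' C := by
      refine mem_of_forall_inner_le ?_ (hcl.preimage (by fun_prop)) fun w u hw => ?_
      · intro a ha a' ha' p q hp hq hpq
        have := hC ha ha' hp hq hpq
        simp only [mem_preimage, map_add, map_smul] at this ⊢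
        convert this using 1
        rw [smul_add, smul_add, add_add_add_comm, ← add_smul, hpq, one_smul]
      · have h1 : ‖w‖ ≤ u := by
          have := hw (‖w‖⁻¹ • w) (hA _ (by
            rw [norm_smul, norm_inv, norm_norm]; exact inv_mul_le_one))
          rw [inner_smul_right, real_inner_self_eq_norm_sq] at this
          rcases eq_or_ne ‖w‖ 0 with h0 | h0
          · rw [h0] at this ⊢; simpa using this
          · rwa [sq, inv_mul_cancel_left₀ h0] at this
        have h2 : s * inner ℝ e w ≤ u := by
          have := hw y hy
          rwa [hye, inner_smul_right, real_inner_comm] at this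
        have h3 : inner ℝ w (D x) ≤ ‖D w‖ := by
          have : inner ℝ w (D x) = inner ℝ (D w) x := by
            simp only [hD, LinearMap.smul_apply, inner_smul_left, inner_smul_right,
              inner_axialStretch, RCLike.conj_to_real]
          rw [this]
          refine (real_inner_le_norm _ _).trans ?_
          nlinarith [norm_nonneg (D w)]
        have h4 := support_spheroid_le (by linarith) ht0 ht1 hβ (p := inner ℝ e w) (q := ‖w‖) (by
          simpa [he1] using abs_real_inner_le_norm e w) h1 h2
        rw [inner_add_right, inner_smul_right, real_inner_comm e w]
        rw [hnorm] at h3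
        rw [← hb] at h4
        linarith
    simpa [add_assoc] using hx'
  have hle := hmax ((A : Euc d →ₗ[ℝ] Euc d) ∘ₗ D) (A (t • e) + c) hmem
  rw [hD, abs_det_comp_smul_axialStretch _ he1, finrank_euclideanSpace, Fintype.card_fin] at hle
  have hdpos : 0 < |LinearMap.det (A : Euc d →ₗ[ℝ] Euc d)| := abs_pos.2 A.isUnit_det'.ne_zero
  have hgt : 1 < |β ^ d * ((1 + t) / β)| := by
    refine (one_lt_sq_iff₀ (abs_nonneg _)).1 ?_
    obtain ⟨k, rfl⟩ : ∃ k, d = k + 1 := ⟨d - 1, by lia⟩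
    have h1 : β ^ (k + 1) * ((1 + t) / β) = β ^ k * (1 + t) := by
      rw [pow_succ]; field_simp
    rw [sq_abs, h1, mul_pow, ← pow_mul, mul_comm k 2, pow_mul, hβ2, mul_comm]
    exact hdet
  nlinarith

/-- The Löwner ellipsoid, scaled by `1 / d` about its center, is contained in the body. -/
theorem mem_of_loewner (hd : 2 ≤ d) {C : Set (Euc d)} (hC : Convex ℝ C) (hcl : IsClosed C)
    (hne : C.Nonempty)
    {A : Euc d ≃ₗ[ℝ] Euc d} {c : Euc d} (hA : ∀ x ∈ C, ‖A.symm (x - c)‖ ≤ 1)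
    (hmax : ∀ (T : Euc d →ₗ[ℝ] Euc d) (b : Euc d), (∀ x ∈ C, ‖T x + b‖ ≤ 1) →
        |LinearMap.det T| ≤ |LinearMap.det (A.symm : Euc d →ₗ[ℝ] Euc d)|) {y : Euc d}
    (hy : d * ‖y‖ ≤ 1) : A y + c ∈ C := by
  have hd' : (2 : ℝ) ≤ d := by exact_mod_cast hd
  refine mem_of_forall_inner_le hC hcl fun v u hu => ?_
  by_contra! hlt
  set w := LinearMap.adjoint (A : Euc d →ₗ[ℝ] Euc d) v with hw
  have hwA : ∀ z, inner ℝ v (A z) = inner ℝ w z := fun z => by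
    rw [hw, LinearMap.adjoint_inner_left]; rfl
  rw [inner_add_right, hwA] at hlt
  have hCv : ∀ x, inner ℝ v x = inner ℝ w (A.symm (x - c)) + inner ℝ v c := fun x => by
    rw [← hwA, LinearEquiv.apply_symm_apply, ← inner_add_right, sub_add_cancel]
  have hw0 : w ≠ 0 := by
    intro h0
    obtain ⟨x, hx⟩ := hne
    have h1 := hu x hx
    rw [hCv x, h0, inner_zero_left] at h1
    rw [h0, inner_zero_left] at hlt
    linarith
  have hwpos : 0 < ‖w‖ := norm_pos_iff.2 hw0
  obtain ⟨e, he⟩ : ∃ e, e = ‖w‖⁻¹ • w := ⟨_, rfl⟩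
  have he1 : ‖e‖ = 1 := by
    rw [he, norm_smul, norm_inv, norm_norm, inv_mul_cancel₀ hwpos.ne']
  -- Height of the separating hyperplane in ball coordinates, clipped at `0` since the stretch lemma
  -- needs `0 ≤ τ`.
  set τ := max 0 (‖w‖⁻¹ * (u - inner ℝ v c)) with hτ
  have hτ0 : 0 ≤ τ := le_max_left _ _
  have hτ1 : d * τ < 1 := by
    have h1 : ‖w‖⁻¹ * (u - inner ℝ v c) < ‖y‖ := by
      rw [inv_mul_lt_iff₀ hwpos]
      linarith [real_inner_le_norm w y]
    rcases max_cases 0 (‖w‖⁻¹ * (u - inner ℝ v c)) with h | h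
    · rw [hτ, h.1, mul_zero]; exact one_pos
    · rw [hτ, h.1]; nlinarith
  have hCτ : ∀ x ∈ C, inner ℝ e (A.symm (x - c)) ≤ τ := by
    intro x hx
    have h1 := hu x hx
    have h2 := hCv x
    refine le_trans ?_ (le_max_right _ _)
    rw [he, inner_smul_left, RCLike.conj_to_real]
    exact mul_le_mul_of_nonneg_left (by linarith) (inv_nonneg.2 hwpos.le)
  obtain ⟨l, hl0, hl⟩ := exists_stretch_loewner (by lia) hτ0 hτ1
  have hτ2 : τ ≤ 1 := by nlinarith
  -- On the slab `-1 ≤ p ≤ τ` the term `l (τ - p)(p + 1)` is nonnegative, so `‖z‖² + l p² + l (1 -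
  -- τ) p ≤ 1 + l τ`. The shift `m` completes the square, and `l²` in `R` absorbs the remainder `(1
  -- + l) m²`.
  set m := l * (1 - τ) / (2 * (1 + l)) with hm
  set R := 1 + l * τ + l ^ 2 with hR
  have hR0 : 0 < R := by positivity
  have hRr : 0 < √R := Real.sqrt_pos.2 hR0
  set S := (√R)⁻¹ • axialStretch e (√(1 + l)) with hS
  have hmem : ∀ x ∈ C, ‖(S ∘ₗ (A.symm : Euc d →ₗ[ℝ] Euc d)) x + S (m • e - A.symm c)‖ ≤ 1 := by
    intro x hx
    set z := A.symm (x - c) with hz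
    have h1 : (S ∘ₗ (A.symm : Euc d →ₗ[ℝ] Euc d)) x + S (m • e - A.symm c) = S (z + m • e) := by
      rw [LinearMap.comp_apply, ← map_add]
      congr 1
      rw [hz, map_sub, LinearEquiv.coe_coe]; abel
    have hz1 : ‖z‖ ≤ 1 := hA x hx
    have hzτ := hCτ x hx
    have hz2 : -1 ≤ inner ℝ e z := by
      have := neg_le_of_abs_le (abs_real_inner_le_norm e z)
      rw [he1] at this; linarith
    have h2 : ‖axialStretch e (√(1 + l)) (z + m • e)‖ ^ 2 ≤ R := by
      rw [norm_axialStretch_sq he1, Real.sq_sqrt (by linarith), norm_add_sq_real, inner_add_right,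
        inner_smul_right, inner_smul_right, norm_smul, real_inner_self_eq_norm_sq, he1,
        real_inner_comm e z, mul_one, Real.norm_eq_abs, sq_abs]
      rw [← hz] at hzτ
      set p := inner ℝ e z
      have h3 : (1 + l) * (2 * m) = l * (1 - τ) := by rw [hm]; field_simp
      have h4 : (1 + l) * m ^ 2 ≤ l ^ 2 := by
        have : m ≤ l := by
          rw [hm, div_le_iff₀ (by positivity)]; nlinarith
        have hm0 : 0 ≤ m := by
          rw [hm]; exact div_nonneg (mul_nonneg hl0.le (by linarith)) (by positivity)
        have hlm : (1 + l) * m ≤ l := by nlinarith [mul_nonneg hl0.le hτ0]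
        calc (1 + l) * m ^ 2 = (1 + l) * m * m := by ring
          _ ≤ l * l := mul_le_mul hlm this hm0 hl0.le
          _ = l ^ 2 := by ring
      have h5 : 0 ≤ l * ((τ - p) * (p + 1)) :=
        mul_nonneg hl0.le (mul_nonneg (by linarith) (by linarith))
      have h6 : ‖z‖ ^ 2 ≤ 1 := pow_le_one₀ (norm_nonneg _) hz1
      have h7 : ‖z‖ ^ 2 + 2 * (m * p) + m ^ 2 + (1 + l - 1) * (p + m * 1 ^ 2) ^ 2 =
          ‖z‖ ^ 2 + ((1 + l) * (2 * m)) * p + l * p ^ 2 + (1 + l) * m ^ 2 := by ring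
      nlinarith
    rw [h1, hS, LinearMap.smul_apply, norm_smul, norm_inv, Real.norm_eq_abs, abs_of_pos hRr]
    refine inv_mul_le_one_of_le₀ (Real.le_sqrt_of_sq_le h2) hRr.le
  have hle := hmax _ _ hmem
  rw [LinearMap.det_comp, hS, LinearMap.det_smul, det_axialStretch he1, finrank_euclideanSpace,
    Fintype.card_fin, abs_mul] at hle
  have hdpos : 0 < |LinearMap.det (A.symm : Euc d →ₗ[ℝ] Euc d)| :=
    abs_pos.2 A.symm.isUnit_det'.ne_zero
  have hgt : 1 < |(√R)⁻¹ ^ d * √(1 + l)| := by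
    refine (one_lt_sq_iff₀ (abs_nonneg _)).1 ?_
    rw [sq_abs, mul_pow, ← pow_mul, mul_comm d 2, pow_mul, inv_pow, Real.sq_sqrt hR0.le,
      Real.sq_sqrt (by linarith), inv_pow, ← div_eq_inv_mul, one_lt_div (by positivity)]
    exact hl
  nlinarith

/-- A point `c` with `-(C - c) ⊆ d • (C - c)`. -/
def IsAsymmetryCenter (d : ℕ) (C : Set (Euc d)) (c : Euc d) : Prop :=
  ∀ x ∈ C, c - (d : ℝ)⁻¹ • (x - c) ∈ C

theorem isAsymmetryCenter_johnPoint (hd : 2 ≤ d) {C : Set (Euc d)} (hC : C ∈ convexBodies d) :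
    IsAsymmetryCenter d C (johnPoint C) := by
  obtain ⟨A, hA, hmax⟩ := johnPoint_spec hC
  have hd0 : (0 : ℝ) < d := by exact_mod_cast (by lia : 0 < d)
  intro x hx
  set y := A.symm (x - johnPoint C) with hy
  have hxy : x = A y + johnPoint C := by rw [hy, LinearEquiv.apply_symm_apply, sub_add_cancel]
  have h1 := norm_le_of_john hd hC.1 hC.2.1.isClosed hA hmax (y := y) (hxy ▸ hx)
  have h2 := hA (-((d : ℝ)⁻¹ • y)) (by
    rw [norm_neg, norm_smul, norm_inv, Real.norm_eq_abs, abs_of_pos hd0]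
    exact inv_mul_le_one_of_le₀ h1 hd0.le)
  convert h2 using 1
  rw [map_neg, map_smul, hy, LinearEquiv.apply_symm_apply]; abel

theorem isAsymmetryCenter_loewnerPoint (hd : 2 ≤ d) {C : Set (Euc d)} (hC : C ∈ convexBodies d) :
    IsAsymmetryCenter d C (loewnerPoint C) := by
  obtain ⟨A, hA, hmax⟩ := loewnerPoint_spec hC
  have hd0 : (0 : ℝ) < d := by exact_mod_cast (by lia : 0 < d)
  intro x hx
  have h2 := mem_of_loewner hd hC.1 hC.2.1.isClosed ⟨x, hx⟩ hA hmax
    (y := -((d : ℝ)⁻¹ • A.symm (x - loewnerPoint C))) (by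
      rw [norm_neg, norm_smul, norm_inv, Real.norm_eq_abs, abs_of_pos hd0,
        mul_inv_cancel_left₀ hd0.ne']
      exact hA x hx)
  convert h2 using 1
  rw [map_neg, map_smul, LinearEquiv.apply_symm_apply]; abel

end Asymmetry

/-! ### Chord lengths and the lower bound. -/

section Chord

variable {E : Type*} [NormedAddCommGroup E] [NormedSpace ℝ E] [MeasurableSpace E] [BorelSpace E]

/-- The trace of a convex body on the line through two of its points. -/
theorem exists_line_inter_eq_segment {C : Set E} (hC : Convex ℝ C) (hcomp : IsCompact C)
    {p q : E} (hpq : p ≠ q) (hp : p ∈ C) :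
    ∃ a b : ℝ, IsLeast {t | AffineMap.lineMap p q t ∈ C} a ∧
      IsGreatest {t | AffineMap.lineMap p q t ∈ C} b ∧
      (Measure.hausdorffMeasure 1 ((line[ℝ, p, q] : Set E) ∩ C)).toReal = (b - a) * ‖p - q‖ := by
  set S : Set ℝ := {t | AffineMap.lineMap p q t ∈ C} with hS
  have hcl : IsClosed S := hcomp.isClosed.preimage AffineMap.lineMap_continuous
  have hd : 0 < dist p q := dist_pos.2 hpq
  have hbd : Bornology.IsBounded S := by
    obtain ⟨M, hM⟩ := isBounded_iff_forall_norm_le.1 hcomp.isBounded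
    refine isBounded_iff_forall_norm_le.2 ⟨(M + M) / dist p q, fun t ht => ?_⟩
    rw [le_div_iff₀ hd, ← dist_lineMap_left, dist_eq_norm]
    exact (norm_sub_le _ _).trans (add_le_add (hM _ ht) (hM _ hp))
  have hK : IsCompact S := Metric.isCompact_of_isClosed_isBounded hcl hbd
  have hne : S.Nonempty := ⟨0, by simpa [hS] using hp⟩
  obtain ⟨a, ha⟩ := hK.exists_isLeast hne
  obtain ⟨b, hb⟩ := hK.exists_isGreatest hne
  refine ⟨a, b, ha, hb, ?_⟩
  have hab : a ≤ b := ha.2 hb.1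
  have hSab : S = segment ℝ a b := by
    rw [segment_eq_Icc hab]
    refine Subset.antisymm (fun t ht => ⟨ha.2 ht, hb.2 ht⟩) ?_
    have hconv : Convex ℝ S := hC.affine_preimage (AffineMap.lineMap p q)
    exact hconv.ordConnected.out ha.1 hb.1
  have hset : (line[ℝ, p, q] : Set E) ∩ C =
      segment ℝ (AffineMap.lineMap p q a) (AffineMap.lineMap p q b) := by
    rw [← image_segment, ← hSab]
    ext x
    simp only [mem_inter_iff, SetLike.mem_coe, mem_affineSpan_pair_iff_exists_lineMap_eq, mem_image]
    constructor
    · rintro ⟨⟨t, rfl⟩, hx⟩; exact ⟨t, hx, rfl⟩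
    · rintro ⟨t, ht, rfl⟩; exact ⟨⟨t, rfl⟩, ht⟩
  rw [hset, hausdorffMeasure_segment, edist_dist, ENNReal.toReal_ofReal dist_nonneg,
    dist_lineMap_lineMap, dist_comm a b, Real.dist_eq, abs_of_nonneg (sub_nonneg.2 hab),
    dist_eq_norm]

end Chord

/-- `c` divides the segment from `x` to its scaled reflection in the ratio `d : 1`. -/
theorem IsAsymmetryCenter.mem {d : ℕ} {C : Set (Euc d)} (hC : Convex ℝ C) (hne : C.Nonempty)
    {c : Euc d} (h : IsAsymmetryCenter d C c) (hd : 1 ≤ d) : c ∈ C := by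
  obtain ⟨x, hx⟩ := hne
  have hd0 : (0 : ℝ) < d := by exact_mod_cast hd
  have := hC hx (h x hx) (a := 1 / (d + 1)) (b := d / (d + 1)) (by positivity) (by positivity)
    (by field_simp; ring)
  convert this using 1
  match_scalars <;> field_simp <;> ring

theorem two_div_le_phiJL {d : ℕ} (hd : 2 ≤ d) {C : Set (Euc d)} (hC : C ∈ convexBodies d) :
    2 / ((d : ℝ) + 1) ≤ phiJL C := by
  have hd' : (2 : ℝ) ≤ d := by exact_mod_cast hd
  have hd0 : (0 : ℝ) < d := by linarith
  have hj := isAsymmetryCenter_johnPoint hd hC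
  have hl := isAsymmetryCenter_loewnerPoint hd hC
  have hne : C.Nonempty := hC.2.2.mono interior_subset
  rw [phiJL, symMeasure]
  split_ifs with heq
  · rw [div_le_one (by linarith)]; linarith
  · set p := johnPoint C
    set q := loewnerPoint C
    obtain ⟨a, b, ha, hb, hlen⟩ := exists_line_inter_eq_segment hC.1 hC.2.1 heq
      (hj.mem hC.1 hne (by lia))
    rw [hlen]
    -- Reflect the endpoint `b` through `j(C)`, and below the endpoint `a` through `l(C)`.
    have h1 : a ≤ -((d : ℝ)⁻¹ * b) := ha.2 (by
      have := hj _ hb.1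
      simp only [mem_ofPred_eq]
      convert this using 1
      simp only [AffineMap.lineMap_apply_module]
      module)
    have h2 : 1 + (d : ℝ)⁻¹ * (1 - a) ≤ b := hb.2 (by
      have := hl _ ha.1
      simp only [mem_ofPred_eq]
      convert this using 1
      simp only [AffineMap.lineMap_apply_module]
      module)
    have hn : 0 < ‖p - q‖ := norm_pos_iff.2 (sub_ne_zero.2 heq)
    have h3 : b ≤ d * (-a) := by
      have := mul_le_mul_of_nonneg_left h1 hd0.le
      rw [mul_neg, mul_inv_cancel_left₀ hd0.ne'] at this
      linarith
    have h4 : 1 - a ≤ d * (b - 1) := by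
      have := mul_le_mul_of_nonneg_left h2 hd0.le
      rw [mul_add, mul_inv_cancel_left₀ hd0.ne'] at this
      linarith
    have h5 : (d : ℝ) + 1 ≤ (b - a) * (d - 1) := by linarith
    have hba : 0 < b - a := by nlinarith
    rw [div_mul_cancel_right₀ hn.ne', div_le_iff₀ (by linarith)]
    have h6 : (b - a)⁻¹ * ((b - a) * (d - 1)) = d - 1 := inv_mul_cancel_left₀ hba.ne' _
    nlinarith [mul_le_mul_of_nonneg_left h5 (inv_pos.2 hba).le]

/-! ### Coordinates `(t, x)` on `ℝ × ℝ^d`. -/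

section PairPt

variable {d : ℕ}

theorem inner_pairPt (t t' : ℝ) (x x' : Euc d) :
    inner ℝ (pairPt t x) (pairPt t' x') = t * t' + inner ℝ x x' := by
  simp [pairPt, PiLp.inner_apply, Fin.sum_univ_succ, mul_comm]

theorem norm_pairPt_sq (t : ℝ) (x : Euc d) : ‖pairPt t x‖ ^ 2 = t ^ 2 + ‖x‖ ^ 2 := by
  rw [← real_inner_self_eq_norm_sq, inner_pairPt, real_inner_self_eq_norm_sq, sq t]

theorem pairPt_add (t t' : ℝ) (x x' : Euc d) :
    pairPt t x + pairPt t' x' = pairPt (t + t') (x + x') := by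
  ext i; refine Fin.cases ?_ (fun i => ?_) i <;> simp [pairPt]

theorem smul_pairPt (r t : ℝ) (x : Euc d) : r • pairPt t x = pairPt (r * t) (r • x) := by
  ext i; refine Fin.cases ?_ (fun i => ?_) i <;> simp [pairPt]

theorem pairPt_zero : pairPt 0 (0 : Euc d) = 0 := by
  ext i; refine Fin.cases ?_ (fun i => ?_) i <;> simp [pairPt]

theorem exists_eq_pairPt (y : Euc (d + 1)) : ∃ t x, y = pairPt t (x : Euc d) := by
  refine ⟨y 0, WithLp.toLp 2 fun i => y i.succ, ?_⟩
  ext i; refine Fin.cases ?_ (fun i => ?_) i <;> simp [pairPt]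

theorem sum_smul_pairPt {ι : Type*} [Fintype ι] (c t : ι → ℝ) (x : ι → Euc d) :
    ∑ i, c i • pairPt (t i) (x i) = pairPt (∑ i, c i * t i) (∑ i, c i • x i) := by
  classical
  refine Finset.induction_on (motive := fun s => ∑ i ∈ s, c i • pairPt (t i) (x i) =
    pairPt (∑ i ∈ s, c i * t i) (∑ i ∈ s, c i • x i)) Finset.univ ?_ fun a s ha ih => ?_
  · simp [pairPt_zero]
  · rw [Finset.sum_insert ha, Finset.sum_insert ha, Finset.sum_insert ha, ih, smul_pairPt,
      pairPt_add]

theorem continuous_pairPt (t : ℝ) : Continuous fun x : Euc d => pairPt t x := by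
  refine (PiLp.continuous_toLp 2 _).comp (continuous_pi fun i => ?_)
  refine Fin.cases ?_ (fun i => ?_) i
  · simpa using continuous_const
  · simp only [Fin.cons_succ]; fun_prop

end PairPt

/-! ### Regular simplices inscribed in the sphere. -/

section RegularFamily

variable {d : ℕ}

/-- The vertices of a regular simplex inscribed in the unit sphere. -/
structure IsRegularFamily (v : Fin (d + 1) → Euc d) : Prop where
  norm_eq : ∀ i, ‖v i‖ = 1
  inner_eq : ∀ i j, i ≠ j → inner ℝ (v i) (v j) = -(d : ℝ)⁻¹

namespace IsRegularFamily

variable {v : Fin (d + 1) → Euc d}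

theorem sum_mul_inner (h : IsRegularFamily v) (a : Fin (d + 1) → ℝ) (j : Fin (d + 1)) :
    ∑ i, a i * inner ℝ (v i) (v j) = a j * (1 + (d : ℝ)⁻¹) - (d : ℝ)⁻¹ * ∑ i, a i := by
  have h1 : ∀ i, a i * inner ℝ (v i) (v j) =
      (if i = j then a j * (1 + (d : ℝ)⁻¹) else 0) - (d : ℝ)⁻¹ * a i := by
    intro i
    split_ifs with hij
    · subst hij; rw [real_inner_self_eq_norm_sq, h.norm_eq]; ring
    · rw [h.inner_eq i j hij]; ring
  simp only [h1, Finset.sum_sub_distrib, ← Finset.mul_sum, Finset.sum_ite_eq', Finset.mem_univ,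
    if_true]

theorem affineIndependent (h : IsRegularFamily v) : AffineIndependent ℝ v := by
  rw [affineIndependent_iff_of_fintype]
  intro w hw hv j
  rw [Finset.weightedVSub_eq_weightedVSubOfPoint_of_sum_eq_zero _ w v hw 0,
    Finset.weightedVSubOfPoint_apply] at hv
  simp only [vsub_eq_sub, sub_zero] at hv
  have h1 := congrArg (fun y => inner ℝ y (v j)) hv
  simp only [sum_inner, inner_smul_left, RCLike.conj_to_real, inner_zero_left,
    h.sum_mul_inner, hw, mul_zero, sub_zero] at h1
  have : (0 : ℝ) < 1 + (d : ℝ)⁻¹ := by positivity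
  exact (mul_eq_zero.1 h1).resolve_right this.ne'

theorem sum_eq_zero (hd : 1 ≤ d) (h : IsRegularFamily v) : ∑ i, v i = 0 := by
  have hd0 : (d : ℝ) ≠ 0 := by exact_mod_cast (by lia : d ≠ 0)
  have h1 : inner ℝ (∑ i, v i) (∑ i, v i) = (0 : ℝ) := by
    rw [inner_sum]
    refine Finset.sum_eq_zero fun j _ => ?_
    have := h.sum_mul_inner (fun _ => 1) j
    simp only [one_mul, Finset.sum_const, Finset.card_univ, Fintype.card_fin, nsmul_eq_mul,
      mul_one] at this
    rw [sum_inner, this]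
    push_cast; field_simp; ring
  exact inner_self_eq_zero.1 h1

/-- The frame operator fixes every `v j` by the Gram relations, and the `v j` span. -/
theorem isJohnDecomposition (hd : 1 ≤ d) (h : IsRegularFamily v) :
    IsJohnDecomposition (fun _ => (d : ℝ) / (d + 1)) v := by
  have hd0 : (0 : ℝ) < d := by exact_mod_cast hd
  refine ⟨fun i => by positivity, h.norm_eq, ?_, ?_⟩
  · rw [← Finset.smul_sum, h.sum_eq_zero hd, smul_zero]
  · have hspan : Submodule.span ℝ (range v) = ⊤ := by
      have h1 := (h.affineIndependent.affineSpan_eq_top_iff_card_eq_finrank_add_one).2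
        (by simp)
      have h2 := affineSpan_subset_span (k := ℝ) (s := range v)
      rw [h1] at h2
      exact eq_top_iff.2 fun x _ => h2 (AffineSubspace.mem_top ℝ _ x)
    set T : Euc d →ₗ[ℝ] Euc d :=
      ∑ i, ((d : ℝ) / (d + 1)) • (innerSL ℝ (v i) : Euc d →ₗ[ℝ] ℝ).smulRight (v i) with hT
    have hTapp : ∀ x, T x = ∑ i, ((d : ℝ) / (d + 1)) • inner ℝ (v i) x • v i := by
      intro x; simp [hT, LinearMap.sum_apply]
    have hid : T = LinearMap.id := by
      refine LinearMap.ext_on hspan ?_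
      rintro _ ⟨j, rfl⟩
      rw [hTapp, LinearMap.id_apply]
      have h1 : ∀ i, ((d : ℝ) / (d + 1)) • inner ℝ (v i) (v j) • v i =
          (if i = j then v j else 0) - ((d : ℝ) + 1)⁻¹ • v i := by
        intro i
        split_ifs with hij
        · subst hij
          rw [real_inner_self_eq_norm_sq, h.norm_eq]
          match_scalars; field_simp; ring
        · rw [h.inner_eq i j hij, smul_smul, zero_sub, ← neg_smul]
          congr 1; field_simp
      simp only [h1, Finset.sum_sub_distrib, ← Finset.smul_sum, h.sum_eq_zero hd, smul_zero,
        sub_zero, Finset.sum_ite_eq', Finset.mem_univ, if_true]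
    intro x
    have h1 : inner ℝ (T x) x = ‖x‖ ^ 2 := by rw [hid]; simp
    rw [← h1, hTapp, sum_inner]
    refine Finset.sum_congr rfl fun i _ => ?_
    rw [inner_smul_left, inner_smul_left]
    simp only [RCLike.conj_to_real]; ring

/-- All Gram entries off the diagonal equal some `g`. Writing `0` as an affine combination and
pairing with each vertex gives `w j (1 - g) + g = 0`; summing over `j` forces `g = -1/d`. -/
theorem of_equilateral (hd : 1 ≤ d) {Δ : Affine.Simplex ℝ (Euc d) d} (hΔ : Δ.Equilateral)
    (hn : ∀ i, ‖Δ.points i‖ = 1) : IsRegularFamily Δ.points := by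
  have hd0 : (0 : ℝ) < d := by exact_mod_cast hd
  obtain ⟨r, hr⟩ := hΔ
  have hr0 : 0 < r := by
    have h01 : (0 : Fin (d + 1)) ≠ Fin.last d := by
      rw [Ne, Fin.ext_iff, Fin.val_zero, Fin.val_last]; lia
    rw [← hr _ _ h01]
    exact dist_pos.2 fun h => h01 (Δ.independent.injective h)
  set g := 1 - r ^ 2 / 2 with hg
  have hgij : ∀ i j, i ≠ j → inner ℝ (Δ.points i) (Δ.points j) = g := by
    intro i j hij
    have h1 := hr i j hij
    have h2 := norm_sub_sq_real (Δ.points i) (Δ.points j)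
    rw [← dist_eq_norm, h1, hn, hn] at h2
    rw [hg]; linarith
  have hg1 : 0 < 1 - g := by rw [hg]; have := pow_pos hr0 2; linarith
  have hsum : ∀ (a : Fin (d + 1) → ℝ) j, ∑ i, a i * inner ℝ (Δ.points i) (Δ.points j) =
      a j * (1 - g) + g * ∑ i, a i := by
    intro a j
    have h1 : ∀ i, a i * inner ℝ (Δ.points i) (Δ.points j) =
        (if i = j then a j * (1 - g) else 0) + g * a i := by
      intro i
      split_ifs with hij
      · subst hij; rw [real_inner_self_eq_norm_sq, hn]; ring
      · rw [hgij i j hij]; ring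
    simp only [h1, Finset.sum_add_distrib, ← Finset.mul_sum, Finset.sum_ite_eq', Finset.mem_univ,
      if_true]
  have h0 : (0 : Euc d) ∈ affineSpan ℝ (range Δ.points) := by
    rw [(Δ.independent.affineSpan_eq_top_iff_card_eq_finrank_add_one).2 (by simp)]
    exact AffineSubspace.mem_top ℝ _ _
  obtain ⟨w, hw1, hw⟩ := eq_affineCombination_of_mem_affineSpan_of_fintype h0
  rw [Finset.affineCombination_eq_linear_combination _ _ _ hw1] at hw
  have hwj : ∀ j, w j * (1 - g) + g = 0 := by
    intro j
    have h1 := congrArg (fun y => inner ℝ y (Δ.points j)) hw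
    simp only [sum_inner, inner_smul_left, RCLike.conj_to_real, inner_zero_left, hsum, hw1] at h1
    linarith
  have h2 : ∑ j : Fin (d + 1), (w j * (1 - g) + g) = 0 := Finset.sum_eq_zero fun j _ => hwj j
  rw [Finset.sum_add_distrib, ← Finset.sum_mul, hw1] at h2
  simp only [Finset.sum_const, Finset.card_univ, Fintype.card_fin, nsmul_eq_mul] at h2
  push_cast at h2
  have hgd : g = -(d : ℝ)⁻¹ := by field_simp; linarith
  exact ⟨hn, fun i j hij => by rw [hgij i j hij, hgd]⟩

/-- The regular simplex with vertex `e₀` over the regular simplex `v` of one dimension less. -/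
noncomputable def lift (v : Fin (d + 1) → Euc d) : Fin (d + 1 + 1) → Euc (d + 1) :=
  Fin.cons (pairPt 1 0) fun i =>
    pairPt (-((d : ℝ) + 1)⁻¹) (-(√(d * (d + 2)) / ((d : ℝ) + 1)) • v i)

theorem lift_isRegularFamily (hd : 1 ≤ d) (h : IsRegularFamily v) : IsRegularFamily (lift v) := by
  have hd0 : (0 : ℝ) < d := by exact_mod_cast hd
  have hκ : (√((d : ℝ) * (d + 2)) / ((d : ℝ) + 1)) ^ 2 = d * (d + 2) / (d + 1) ^ 2 := by
    rw [div_pow, Real.sq_sqrt (by positivity)]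
  constructor
  · intro i
    refine (pow_eq_one_iff_of_nonneg (norm_nonneg _) two_ne_zero).1 ?_
    refine Fin.cases ?_ (fun i => ?_) i
    · simp [lift, norm_pairPt_sq]
    · simp only [lift, Fin.cons_succ, norm_pairPt_sq, norm_smul, h.norm_eq, mul_one, norm_neg,
        Real.norm_eq_abs, sq_abs, hκ]
      field_simp; ring
  · intro i j
    refine Fin.cases ?_ (fun i => ?_) i <;> refine Fin.cases ?_ (fun j => ?_) j
    · simp
    · intro _; simp [lift, inner_pairPt]
    · intro _; simp [lift, inner_pairPt]
    · intro hij
      simp only [lift, Fin.cons_succ, inner_pairPt, inner_smul_left, inner_smul_right,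
        RCLike.conj_to_real, h.inner_eq i j (fun h => hij (by rw [h]))]
      have : ∀ x : ℝ, -x * (-x * -(d : ℝ)⁻¹) = -(x ^ 2 * (d : ℝ)⁻¹) := fun x => by ring
      rw [this, hκ]
      push_cast; field_simp; ring

theorem exists_family (hd : 1 ≤ d) : ∃ v : Fin (d + 1) → Euc d, IsRegularFamily v := by
  induction d, hd using Nat.le_induction with
  | base =>
    refine ⟨fun i => if i = 0 then EuclideanSpace.single 0 1 else -EuclideanSpace.single 0 1,
      fun i => ?_, fun i j hij => ?_⟩
    · fin_cases i <;> simp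
    · fin_cases i <;> fin_cases j <;> simp at hij ⊢
  | succ d hd ih =>
    obtain ⟨v, hv⟩ := ih
    exact ⟨_, hv.lift_isRegularFamily hd⟩

end IsRegularFamily

end RegularFamily

/-! ### From certificates to centers. -/

section Certificates

variable {d : ℕ} {ι : Type*} [Fintype ι] {c : ι → ℝ} {u : ι → Euc d}

/-- The unit ball competes with the optimal ellipsoid, so the latter falls under the equality case
of `loewner`. -/
theorem IsJohnDecomposition.loewnerPoint_eq_zero (h : IsJohnDecomposition c u) {C : Set (Euc d)}
    (hC : C ∈ convexBodies d) (hu : ∀ i, u i ∈ C) (hball : ∀ x ∈ C, ‖x‖ ≤ 1) :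
    loewnerPoint C = 0 := by
  obtain ⟨A, hA, hmax⟩ := loewnerPoint_spec hC
  have h1 := hmax LinearMap.id 0 fun x hx => by simpa using hball x hx
  have h2 := (h.loewner (A.symm : Euc d →ₗ[ℝ] Euc d) (-A.symm (loewnerPoint C)) fun i => by
    simpa [sub_eq_add_neg] using hA _ (hu i)).2 (by simpa using h1)
  simpa using h2

/-- Pulling back along `x ↦ A₀ x + c₀` turns the candidate into the unit ball, where the equality
case of `john` applies. -/
theorem IsJohnDecomposition.johnPoint_eq (h : IsJohnDecomposition c u) {C : Set (Euc d)}
    (hC : C ∈ convexBodies d) {A₀ : Euc d →ₗ[ℝ] Euc d} (hdet : LinearMap.det A₀ ≠ 0) {c₀ : Euc d}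
    (hA₀ : ∀ x, ‖x‖ ≤ 1 → A₀ x + c₀ ∈ C) (hu : ∀ i z, A₀ z + c₀ ∈ C → inner ℝ (u i) z ≤ 1) :
    johnPoint C = c₀ := by
  obtain ⟨A, hA, hmax⟩ := johnPoint_spec hC
  set B := LinearMap.equivOfDetNeZero A₀ hdet with hB
  have hBapp : ∀ x, A₀ (B.symm x) = x := fun x => B.apply_symm_apply x
  have h1 := (h.john ((B.symm : Euc d →ₗ[ℝ] Euc d) ∘ₗ (A : Euc d →ₗ[ℝ] Euc d))
    (B.symm (johnPoint C - c₀)) fun i x hx => hu i _ (by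
      rw [map_add, hBapp, LinearMap.comp_apply, LinearEquiv.coe_coe, hBapp]
      rw [add_assoc, sub_add_cancel]; exact hA x hx)).2 (by
    rw [LinearMap.det_comp, abs_mul]
    have h2 := hmax A₀ c₀ hA₀
    have h3 : |LinearMap.det (B.symm : Euc d →ₗ[ℝ] Euc d)| * |LinearMap.det A₀| = 1 := by
      rw [← abs_mul]
      exact (congrArg abs (LinearEquiv.det_symm_mul_det B)).trans abs_one
    rw [← h3]
    exact mul_le_mul_of_nonneg_left h2 (abs_nonneg _))
  exact sub_eq_zero.1 (B.symm.map_eq_zero_iff.1 h1)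

end Certificates

/-! ### The body `C_d` and its Löwner ellipsoid. -/

section Body

variable {d : ℕ}

/-- The discriminant is the perfect square `(d + 1 - 1/d) ^ 2`. -/
theorem epsSeq_eq (hd : 2 ≤ d) : epsSeq d = 1 / ((d + 1) * √(1 - 1 / (d : ℝ))) := by
  have hd' : (2 : ℝ) ≤ d := by exact_mod_cast hd
  have hd0 : (0 : ℝ) < d := by linarith
  have h1 : 0 < 1 - 1 / (d : ℝ) := by
    rw [sub_pos, div_lt_one hd0]; linarith
  have h2 : ((d : ℝ) - 1 - 1 / d) ^ 2 + 4 * (d + 1) * (1 - 1 / d) = (d + 1 - 1 / d) ^ 2 := by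
    field_simp; ring
  have h3 : 0 < √(1 - 1 / (d : ℝ)) := Real.sqrt_pos.2 h1
  rw [epsSeq, h2, Real.sqrt_sq (by linarith)]
  field_simp; ring

/-- Upper bounds for a linear functional on the convex hull. -/
theorem inner_le_of_mem_bodyC {Δ : Affine.Simplex ℝ (Euc d) d} {p u : ℝ} {w : Euc d}
    (hbot : ∀ i, -epsSeq d * p + √(1 - epsSeq d ^ 2) * inner ℝ w (Δ.points i) ≤ u)
    (htop : √(1 - 1 / (d : ℝ)) * p + 1 / √(d : ℝ) * ‖w‖ ≤ u) {y : Euc (d + 1)}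
    (hy : y ∈ bodyC d Δ) : inner ℝ (pairPt p w) y ≤ u := by
  have hhalf : ∀ {E : Type} [NormedAddCommGroup E] [InnerProductSpace ℝ E] (w : E) (u : ℝ),
      Convex ℝ {y : E | inner ℝ w y ≤ u} := fun w u =>
    convex_halfSpace_le (innerSL ℝ w).toLinearMap.isLinear u
  refine convexHull_min (union_subset ?_ ?_) (hhalf (pairPt p w) u) hy
  · rintro _ ⟨x, hx, rfl⟩
    simp only [mem_ofPred_eq, inner_pairPt, inner_smul_right]
    have hsub : convexHull ℝ (range Δ.points) ⊆
        {x | inner ℝ (√(1 - epsSeq d ^ 2) • w) x ≤ u + epsSeq d * p} := by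
      refine convexHull_min ?_ (hhalf _ _)
      rintro _ ⟨i, rfl⟩
      simp only [mem_ofPred_eq, inner_smul_left, RCLike.conj_to_real]
      linarith [hbot i]
    have := hsub hx
    simp only [mem_ofPred_eq, inner_smul_left, RCLike.conj_to_real] at this
    linarith
  · rintro _ ⟨x, hx, rfl⟩
    rw [mem_closedBall_zero_iff] at hx
    simp only [mem_ofPred_eq, inner_pairPt, inner_smul_right]
    have h1 : inner ℝ w x ≤ ‖w‖ := (real_inner_le_norm w x).trans
      (mul_le_of_le_one_right (norm_nonneg _) hx)
    have h2 : 1 / √(d : ℝ) * inner ℝ w x ≤ 1 / √(d : ℝ) * ‖w‖ :=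
      mul_le_mul_of_nonneg_left h1 (by positivity)
    linarith

theorem bottom_mem_bodyC (Δ : Affine.Simplex ℝ (Euc d) d) (i : Fin (d + 1)) :
    pairPt (-epsSeq d) (√(1 - epsSeq d ^ 2) • Δ.points i) ∈ bodyC d Δ :=
  subset_convexHull ℝ _ (Or.inl ⟨_, subset_convexHull ℝ _ (mem_range_self i), rfl⟩)

theorem top_mem_bodyC (Δ : Affine.Simplex ℝ (Euc d) d) {x : Euc d} (hx : ‖x‖ ≤ 1) :
    pairPt √(1 - 1 / (d : ℝ)) ((1 / √(d : ℝ)) • x) ∈ bodyC d Δ :=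
  subset_convexHull ℝ _ (Or.inr ⟨x, by simpa using hx, rfl⟩)

theorem IsCompact.convexHull_union {E : Type*} [NormedAddCommGroup E] [NormedSpace ℝ E]
    {s t : Set E} (hs : IsCompact s) (ht : IsCompact t) (hsc : Convex ℝ s) (htc : Convex ℝ t)
    (hsne : s.Nonempty) (htne : t.Nonempty) : IsCompact (convexHull ℝ (s ∪ t)) := by
  have h1 : convexHull ℝ (s ∪ t) =
      (fun p : ℝ × E × E => AffineMap.lineMap p.2.1 p.2.2 p.1) '' (Icc (0 : ℝ) 1 ×ˢ s ×ˢ t) := by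
    rw [hsc.convexHull_union htc hsne htne]
    ext x
    simp only [mem_convexJoin, segment_eq_image_lineMap, mem_image, Prod.exists, mem_prod]
    constructor
    · rintro ⟨a, ha, b, hb, r, hr, rfl⟩; exact ⟨r, a, b, ⟨hr, ha, hb⟩, rfl⟩
    · rintro ⟨r, a, b, ⟨hr, ha, hb⟩, rfl⟩; exact ⟨a, ha, b, hb, r, hr, rfl⟩
  rw [h1]
  refine (isCompact_Icc.prod (hs.prod ht)).image ?_
  simp only [AffineMap.lineMap_apply_module]
  fun_prop

theorem Convex.image_pairPt_smul {s : Set (Euc d)} (hs : Convex ℝ s) (t r : ℝ) :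
    Convex ℝ ((fun x => pairPt t (r • x)) '' s) := by
  rintro _ ⟨x, hx, rfl⟩ _ ⟨y, hy, rfl⟩ a b ha hb hab
  refine ⟨a • x + b • y, hs hx hy ha hb hab, ?_⟩
  simp only [smul_pairPt, pairPt_add]
  congr 1
  · rw [← add_mul, hab, one_mul]
  · module

theorem isCompact_bodyC (Δ : Affine.Simplex ℝ (Euc d) d) : IsCompact (bodyC d Δ) := by
  refine IsCompact.convexHull_union ?_ ?_ ?_ ?_ ?_ ?_
  · exact ((finite_range _).isCompact_convexHull ℝ).image
      ((continuous_pairPt _).comp (continuous_const_smul _))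
  · exact (isCompact_closedBall _ _).image ((continuous_pairPt _).comp (continuous_const_smul _))
  · exact (convex_convexHull ℝ _).image_pairPt_smul _ _
  · exact (convex_closedBall _ _).image_pairPt_smul _ _
  · exact ((range_nonempty _).convexHull).image _
  · exact ⟨_, mem_image_of_mem _ (Metric.mem_closedBall_self zero_le_one)⟩

/-- The numerical facts about the parameters `k = √(1 - 1/d)`, `ε`, `s = √(1 - ε²)`, `r = 1/√d`. -/
theorem body_params (hd : 2 ≤ d) :
    0 < √(1 - 1 / (d : ℝ)) ∧ √(1 - 1 / (d : ℝ)) ^ 2 = 1 - 1 / d ∧ 0 < epsSeq d ∧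
      (d + 1) * √(1 - 1 / (d : ℝ)) * epsSeq d = 1 ∧ epsSeq d < √(1 - 1 / (d : ℝ)) ∧
      0 < √(1 - epsSeq d ^ 2) ∧ √(1 - epsSeq d ^ 2) ^ 2 = 1 - epsSeq d ^ 2 ∧
      0 < 1 / √(d : ℝ) ∧ (1 / √(d : ℝ)) ^ 2 = 1 / d := by
  have hd' : (2 : ℝ) ≤ d := by exact_mod_cast hd
  have hd0 : (0 : ℝ) < d := by linarith
  have h1 : 1 / (d : ℝ) ≤ 1 / 2 := by gcongr
  have hk : 0 < √(1 - 1 / (d : ℝ)) := Real.sqrt_pos.2 (by linarith)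
  have hk2 : √(1 - 1 / (d : ℝ)) ^ 2 = 1 - 1 / d := Real.sq_sqrt (by linarith)
  have he := epsSeq_eq hd
  set k := √(1 - 1 / (d : ℝ))
  have he0 : 0 < epsSeq d := by rw [he]; positivity
  have hek : (d + 1) * k * epsSeq d = 1 := by rw [he]; field_simp
  have hlt : epsSeq d < k := by
    by_contra! h
    have : (3 : ℝ) * k * k ≤ (d + 1) * k * epsSeq d := by
      gcongr; linarith
    nlinarith
  have hs : 0 < 1 - epsSeq d ^ 2 := by
    have : 0 < 1 / (d : ℝ) := by positivity
    nlinarith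
  refine ⟨hk, hk2, he0, hek, hlt, Real.sqrt_pos.2 hs, Real.sq_sqrt hs.le, by positivity, ?_⟩
  rw [div_pow, Real.sq_sqrt hd0.le, one_pow]

theorem norm_le_one_of_mem_bodyC (hd : 2 ≤ d) {Δ : Affine.Simplex ℝ (Euc d) d}
    (hn : ∀ i, ‖Δ.points i‖ = 1) {y : Euc (d + 1)} (hy : y ∈ bodyC d Δ) : ‖y‖ ≤ 1 := by
  obtain ⟨hk, hk2, he, hek, hlt, hs, hs2, hr, hr2⟩ := body_params hd
  suffices h : bodyC d Δ ⊆ Metric.closedBall 0 1 by simpa using h hy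
  refine convexHull_min (union_subset ?_ ?_) (convex_closedBall _ _)
  · rintro _ ⟨x, hx, rfl⟩
    have hx1 : ‖x‖ ≤ 1 := by
      have : convexHull ℝ (range Δ.points) ⊆ Metric.closedBall 0 1 :=
        convexHull_min (by rintro _ ⟨i, rfl⟩; simp [hn]) (convex_closedBall _ _)
      simpa using this hx
    rw [mem_closedBall_zero_iff, ← sq_le_one_iff₀ (norm_nonneg _), norm_pairPt_sq, norm_smul,
      mul_pow, Real.norm_eq_abs, sq_abs, hs2]
    have := pow_le_one₀ (n := 2) (norm_nonneg x) hx1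
    nlinarith [hs2 ▸ pow_pos hs 2]
  · rintro _ ⟨x, hx, rfl⟩
    rw [mem_closedBall_zero_iff] at hx ⊢
    rw [← sq_le_one_iff₀ (norm_nonneg _), norm_pairPt_sq, norm_smul,
      mul_pow, Real.norm_eq_abs, sq_abs, hk2, hr2]
    have := pow_le_one₀ (n := 2) (norm_nonneg x) hx
    have h1 : 0 < 1 / (d : ℝ) := hr2 ▸ pow_pos hr 2
    nlinarith

/-- With weights `a` below and `b` above, balance is `a ε = b k` and the axial second moment is `(d
+ 1)(a ε² + b k²) = 1`; these determine `a` and `b`. The horizontal moment then requires `a + b =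
1`, which is exactly `(d + 1) k ε = 1`. -/
theorem loewner_decomposition (hd : 2 ≤ d) {v : Fin (d + 1) → Euc d} (h : IsRegularFamily v) :
    IsJohnDecomposition
      (Sum.elim (fun _ : Fin (d + 1) => 1 / ((d + 1) * (epsSeq d * (epsSeq d + √(1 - 1 / (d : ℝ))))))
        fun _ : Fin (d + 1) =>
          1 / ((d + 1) * (√(1 - 1 / (d : ℝ)) * (epsSeq d + √(1 - 1 / (d : ℝ))))))
      (Sum.elim (fun i => pairPt (-epsSeq d) (√(1 - epsSeq d ^ 2) • v i))
        fun i => pairPt √(1 - 1 / (d : ℝ)) ((1 / √(d : ℝ)) • v i)) := by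
  have hd' : (2 : ℝ) ≤ d := by exact_mod_cast hd
  have hd0 : (0 : ℝ) < d := by linarith
  obtain ⟨hk, hk2, he, hek, hlt, hs, hs2, hr, hr2⟩ := body_params hd
  set k := √(1 - 1 / (d : ℝ))
  set ε := epsSeq d
  set s := √(1 - ε ^ 2)
  set r := 1 / √(d : ℝ)
  have hv := h.isJohnDecomposition (by lia)
  have hvsum := h.sum_eq_zero (by lia)
  set a := 1 / ((d + 1) * (ε * (ε + k))) with ha
  set b := 1 / ((d + 1) * (k * (ε + k))) with hb
  have hab : a * ε = b * k := by rw [ha, hb]; field_simp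
  have h1 : (d + 1) * (a * ε ^ 2 + b * k ^ 2) = 1 := by rw [ha, hb]; field_simp
  have h2 : a + b = 1 := by
    have : a + b = 1 / ((d + 1) * k * ε) := by rw [ha, hb]; field_simp; ring
    rw [this, hek, div_one]
  refine ⟨?_, ?_, ?_, ?_⟩
  · rintro (i | i)
    · simp only [Sum.elim_inl, ha]; positivity
    · simp only [Sum.elim_inr, hb]; positivity
  · rintro (i | i)
    · refine (pow_eq_one_iff_of_nonneg (norm_nonneg _) two_ne_zero).1 ?_
      simp only [Sum.elim_inl, norm_pairPt_sq, norm_smul, h.norm_eq, mul_one, Real.norm_eq_abs,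
        sq_abs, hs2]
      ring
    · refine (pow_eq_one_iff_of_nonneg (norm_nonneg _) two_ne_zero).1 ?_
      simp only [Sum.elim_inr, norm_pairPt_sq, norm_smul, h.norm_eq, mul_one, Real.norm_eq_abs,
        sq_abs, hr2, hk2]
      ring
  · rw [Fintype.sum_sum_type]
    simp only [Sum.elim_inl, Sum.elim_inr]
    rw [sum_smul_pairPt, sum_smul_pairPt, ← pairPt_zero]
    simp only [← Finset.smul_sum, hvsum, smul_zero, pairPt_add, add_zero]
    congr 1
    simp only [Finset.sum_const, Finset.card_univ, Fintype.card_fin, nsmul_eq_mul]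
    linear_combination (-(((d + 1 : ℕ) : ℝ))) * hab
  · intro y
    obtain ⟨t, x, rfl⟩ := exists_eq_pairPt y
    have hsq : ∀ c T R : ℝ, ∑ i, c * inner ℝ (pairPt T (R • v i)) (pairPt t x) ^ 2 =
        c * ((d + 1) * T ^ 2 * t ^ 2 + R ^ 2 * ((d + 1) / d) * ‖x‖ ^ 2) := by
      intro c T R
      have e1 := hv.sum_inner x
      have e2 := hv.sum_sq x
      rw [← Finset.mul_sum] at e1 e2
      have e1' : ∑ i, inner ℝ (v i) x = 0 := (mul_eq_zero.1 e1).resolve_left (by positivity)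
      have e2' : ∑ i, inner ℝ (v i) x ^ 2 = (d + 1) / d * ‖x‖ ^ 2 := by
        rw [← e2]; field_simp
      have e3 : ∀ i, inner ℝ (pairPt T (R • v i)) (pairPt t x) ^ 2 =
          T ^ 2 * t ^ 2 + 2 * T * t * R * inner ℝ (v i) x + R ^ 2 * inner ℝ (v i) x ^ 2 := by
        intro i
        rw [inner_pairPt, inner_smul_left, RCLike.conj_to_real]; ring
      rw [← Finset.mul_sum]
      simp only [e3, Finset.sum_add_distrib, ← Finset.mul_sum, e1', e2', Finset.sum_const,
        Finset.card_univ, Fintype.card_fin, nsmul_eq_mul]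
      push_cast; ring
    rw [Fintype.sum_sum_type]
    simp only [Sum.elim_inl, Sum.elim_inr, hsq, norm_pairPt_sq, hs2, hr2]
    have h3 : (d + 1) * (a * (1 - ε ^ 2) + b * (1 / d)) = d := by
      have : 1 / (d : ℝ) = 1 - k ^ 2 := by rw [hk2]; ring
      rw [this]; linear_combination (d + 1) * h2 - h1
    have h4 : (1 : ℝ) = (d + 1) * (a * (1 - ε ^ 2) + b * (1 / d)) / d := by
      rw [h3, div_self hd0.ne']
    rw [neg_sq]
    linear_combination t ^ 2 * h1 - ‖x‖ ^ 2 * h4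

theorem loewner_vector_mem_bodyC {Δ : Affine.Simplex ℝ (Euc d) d} (hn : ∀ i, ‖Δ.points i‖ = 1)
    (i : Fin (d + 1) ⊕ Fin (d + 1)) :
    Sum.elim (fun i => pairPt (-epsSeq d) (√(1 - epsSeq d ^ 2) • Δ.points i))
        (fun i => pairPt √(1 - 1 / (d : ℝ)) ((1 / √(d : ℝ)) • Δ.points i)) i ∈ bodyC d Δ := by
  rcases i with i | i
  · exact bottom_mem_bodyC Δ i
  · exact top_mem_bodyC Δ (hn i).le

theorem convex_bodyC (Δ : Affine.Simplex ℝ (Euc d) d) : Convex ℝ (bodyC d Δ) :=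
  convex_convexHull ℝ _

/-- A closed convex set containing the vectors of a John decomposition contains a ball. -/
theorem IsJohnDecomposition.mem_of_norm_mul_le {ι : Type*} [Fintype ι] {c : ι → ℝ}
    {u : ι → Euc d} (h : IsJohnDecomposition c u) {C : Set (Euc d)} (hC : Convex ℝ C)
    (hcl : IsClosed C) (hd : 1 ≤ d) (hu : ∀ i, u i ∈ C) {x : Euc d} (hx : d * ‖x‖ ≤ 1) : x ∈ C := by
  refine mem_of_forall_inner_le hC hcl fun w M hM => ?_
  have h1 := h.norm_le_of_inner_le (w := w) (M := M) fun i => by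
    rw [real_inner_comm]; exact hM _ (hu i)
  rw [finrank_euclideanSpace, Fintype.card_fin] at h1
  have hd0 : (0 : ℝ) < d := by exact_mod_cast hd
  have h2 := real_inner_le_norm w x
  nlinarith [norm_nonneg x, norm_nonneg w]

/-- The Löwner certificate itself yields an interior ball, of radius `1/(d + 1)`. -/
theorem bodyC_mem_convexBodies (hd : 2 ≤ d) {Δ : Affine.Simplex ℝ (Euc d) d}
    (h : IsRegularFamily Δ.points) : bodyC d Δ ∈ convexBodies (d + 1) := by
  refine ⟨convex_bodyC Δ, isCompact_bodyC Δ, 0, ?_⟩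
  rw [mem_interior_iff_mem_nhds]
  refine Filter.mem_of_superset (Metric.closedBall_mem_nhds (0 : Euc (d + 1))
    (ε := ((d + 1 : ℕ) : ℝ)⁻¹) (by positivity)) fun x hx => ?_
  refine (loewner_decomposition hd h).mem_of_norm_mul_le (convex_bodyC Δ)
    (isCompact_bodyC Δ).isClosed (by lia) (loewner_vector_mem_bodyC h.norm_eq) ?_
  rw [mem_closedBall_zero_iff] at hx
  calc _ ≤ ((d + 1 : ℕ) : ℝ) * ((d + 1 : ℕ) : ℝ)⁻¹ := by gcongr
    _ = 1 := mul_inv_cancel₀ (by positivity)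

theorem loewnerPoint_bodyC (hd : 2 ≤ d) {Δ : Affine.Simplex ℝ (Euc d) d}
    (h : IsRegularFamily Δ.points) : loewnerPoint (bodyC d Δ) = 0 :=
  (loewner_decomposition hd h).loewnerPoint_eq_zero (bodyC_mem_convexBodies hd h)
    (loewner_vector_mem_bodyC h.norm_eq) fun _ hx => norm_le_one_of_mem_bodyC hd h.norm_eq hx

end Body

/-! ### The John ellipsoid of `C_d`. -/

section JohnBody

/-- Support function estimate: the ball inscribed in a cone of revolution lies in the frustum cut
off at the height `-m`. -/
theorem support_ball_le_frustum {n m y P V : ℝ} (hn : 1 < n) (hm : 1 ≤ m) (hy : 0 ≤ y)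
    (h1 : P + (n + 1) * y ≤ V) (h2 : -m * P + (n - m) * y ≤ V) :
    √(P ^ 2 + (n ^ 2 - 1) * y ^ 2) ≤ V := by
  rcases le_total (-y) P with hP | hP
  · have h3 : 0 ≤ P + (n + 1) * y := by nlinarith
    refine (Real.sqrt_le_iff.2 ⟨h3, ?_⟩).trans h1
    nlinarith [mul_nonneg (mul_nonneg (by linarith : 0 ≤ n + 1) hy) (by linarith : 0 ≤ P + y)]
  · have h3 : n * y - P - y ≤ V := by
      nlinarith [mul_nonneg (sub_nonneg.2 hm) (by linarith : 0 ≤ -P - y)]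
    have h4 : 0 ≤ n * y - P - y := by nlinarith
    refine (Real.sqrt_le_iff.2 ⟨h4, ?_⟩).trans h3
    nlinarith [mul_nonneg (mul_nonneg (by linarith : 0 ≤ n - 1) hy) (by linarith : 0 ≤ -P - y)]

variable {d : ℕ}

/-- The diagonal map `(t, x) ↦ (α t, β x)`. -/
noncomputable def pairScale (d : ℕ) (α β : ℝ) : Euc (d + 1) →ₗ[ℝ] Euc (d + 1) :=
  β • axialStretch (pairPt 1 0) (α / β)

theorem pairScale_apply {α β : ℝ} (hβ : β ≠ 0) (t : ℝ) (x : Euc d) :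
    pairScale d α β (pairPt t x) = pairPt (α * t) (β • x) := by
  rw [pairScale, LinearMap.smul_apply, axialStretch_apply, inner_pairPt, inner_zero_left,
    smul_pairPt, pairPt_add, smul_pairPt, smul_zero, add_zero]
  rw [add_zero]
  congr 1
  field_simp; ring

theorem det_pairScale_ne_zero {α β : ℝ} (hα : α ≠ 0) (hβ : β ≠ 0) :
    LinearMap.det (pairScale d α β) ≠ 0 := by
  have he : ‖pairPt 1 (0 : Euc d)‖ = 1 :=
    (pow_eq_one_iff_of_nonneg (norm_nonneg _) two_ne_zero).1 (by simp [norm_pairPt_sq])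
  rw [pairScale, LinearMap.det_smul, det_axialStretch he]
  exact mul_ne_zero (pow_ne_zero _ hβ) (div_ne_zero hα hβ)

/-- The ratio of the inradius of the bottom face of the body to the radius of its top face. -/
noncomputable def bodyRatio (d : ℕ) : ℝ := √(1 - epsSeq d ^ 2) * (1 / √(d : ℝ))

/-- The vertical semi-axis of the John ellipsoid of the body. -/
noncomputable def bodySemiaxis (d : ℕ) : ℝ :=
  (√(1 - 1 / (d : ℝ)) + epsSeq d) / ((d + 2) * (1 - bodyRatio d))

theorem bodyRatio_le (hd : 2 ≤ d) : bodyRatio d ≤ 1 / √(d : ℝ) := by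
  obtain ⟨hk, hk2, he, hek, hlt, hs, hs2, hr, hr2⟩ := body_params hd
  refine mul_le_of_le_one_left hr.le ?_
  exact Real.sqrt_le_one.2 (by nlinarith)

theorem one_div_sqrt_le (hd : 4 ≤ d) : 1 / √(d : ℝ) ≤ 1 / 2 := by
  have h1 : (2 : ℝ) ≤ √(d : ℝ) := Real.le_sqrt_of_sq_le (by
    have : (4 : ℝ) ≤ d := by exact_mod_cast hd
    linarith)
  gcongr

theorem bodyRatio_le_half (hd : 4 ≤ d) : bodyRatio d ≤ 1 / 2 :=
  (bodyRatio_le (by lia)).trans (one_div_sqrt_le hd)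

theorem bodySemiaxis_pos (hd : 4 ≤ d) : 0 < bodySemiaxis d := by
  obtain ⟨hk, hk2, he, hek, hlt, hs, hs2, hr, hr2⟩ := body_params (d := d) (by lia)
  have := bodyRatio_le_half hd
  refine div_pos (by linarith) (mul_pos (by positivity) (by linarith))

theorem bodySemiaxis_lt (hd : 4 ≤ d) : bodySemiaxis d < √(1 - 1 / (d : ℝ)) := by
  obtain ⟨hk, hk2, he, hek, hlt, hs, hs2, hr, hr2⟩ := body_params (d := d) (by lia)
  have h1 := bodyRatio_le_half hd
  have hd' : (4 : ℝ) ≤ d := by exact_mod_cast hd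
  have h2 : 2 ≤ (d + 2) * (1 - bodyRatio d) := by nlinarith
  rw [bodySemiaxis, div_lt_iff₀ (by linarith)]
  nlinarith

/-- The horizontal radius shrinks by the factor `τ` from the top to the bottom, over the height `k +
ε`, so the cone through both discs has height `(k + ε)/(1 - τ)`. The inscribed ellipsoid has
vertical semi-axis `1/(d + 2)` of that height and horizontal semi-axes `1/√(d + 2)`. For `d ≥ 4`, `τ
≤ 1/2` keeps it above the bottom face. -/
theorem johnPoint_bodyC (hd : 4 ≤ d) {Δ : Affine.Simplex ℝ (Euc d) d}
    (h : IsRegularFamily Δ.points) :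
    johnPoint (bodyC d Δ) = pairPt (√(1 - 1 / (d : ℝ)) - bodySemiaxis d) 0 := by
  have hd' : (4 : ℝ) ≤ d := by exact_mod_cast hd
  have hd0 : (0 : ℝ) < d := by linarith
  have hd2 : 2 ≤ d := by lia
  have hC := bodyC_mem_convexBodies hd2 h
  obtain ⟨hk, hk2, he, hek, hlt, hs, hs2, hr, hr2⟩ := body_params hd2
  have hτ := bodyRatio_le_half hd
  have hα := bodySemiaxis_pos hd
  have hbot := bottom_mem_bodyC Δ
  have htop := fun x => top_mem_bodyC (d := d) Δ (x := x)
  have hup := fun p u w => inner_le_of_mem_bodyC (d := d) (Δ := Δ) (p := p) (u := u) (w := w)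
  have hv := h.isJohnDecomposition (by lia)
  have hαdef : bodySemiaxis d * ((d + 2) * (1 - bodyRatio d)) = √(1 - 1 / (d : ℝ)) + epsSeq d :=
    div_mul_cancel₀ _ (mul_pos (by positivity) (by linarith)).ne'
  have hτdef : bodyRatio d = √(1 - epsSeq d ^ 2) * (1 / √(d : ℝ)) := rfl
  set k := √(1 - 1 / (d : ℝ))
  set ε := epsSeq d
  set s := √(1 - ε ^ 2)
  set r := 1 / √(d : ℝ) with hrdef
  set τ := bodyRatio d
  set α := bodySemiaxis d
  -- In units of `α`, the depth of the bottom face below the center of the ellipsoid.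
  set m := (d : ℝ) + 1 - (d + 2) * τ with hm
  have hm1 : 1 ≤ m := by nlinarith
  have hmα : α * m = k - α + ε := by linear_combination hαdef
  set q := √((d : ℝ) + 2) with hq
  have hq0 : 0 < q := Real.sqrt_pos.2 (by linarith)
  have hq2 : q ^ 2 = d + 2 := Real.sq_sqrt (by linarith)
  have hr2' : r ^ 2 * d = 1 := by rw [hr2]; field_simp
  have hβ : q⁻¹ ≠ 0 := inv_ne_zero hq0.ne'
  have hdecomp := (h.lift_isRegularFamily (by lia)).isJohnDecomposition (by lia)
  refine hdecomp.johnPoint_eq hC (A₀ := pairScale d α q⁻¹) (det_pairScale_ne_zero hα.ne' hβ) ?_ ?_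
  · intro z hz
    obtain ⟨t, x, rfl⟩ := exists_eq_pairPt z
    rw [pairScale_apply hβ, pairPt_add, add_zero]
    refine mem_of_forall_inner_le hC.1 hC.2.1.isClosed fun w' u hu => ?_
    obtain ⟨p, w, rfl⟩ := exists_eq_pairPt w'
    have htop' : k * p + r * ‖w‖ ≤ u := by
      have := hu _ (htop (‖w‖⁻¹ • w) (by
        rw [norm_smul, norm_inv, norm_norm]; exact inv_mul_le_one))
      rw [inner_pairPt, inner_smul_right, inner_smul_right, real_inner_self_eq_norm_sq] at this
      rcases eq_or_ne ‖w‖ 0 with h0 | h0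
      · rw [h0] at this ⊢; linarith
      · rw [sq, inv_mul_cancel_left₀ h0] at this; linarith
    -- The bottom simplex is replaced by its inball, of radius `s / d`.
    have hbot' : -ε * p + s * (‖w‖ / d) ≤ u := by
      have h1 := hv.norm_le_of_inner_le (w := w) (M := (u + ε * p) / s) fun i => by
        have := hu _ (hbot i)
        rw [inner_pairPt, inner_smul_right, real_inner_comm] at this
        rw [le_div_iff₀ hs]; linarith
      rw [finrank_euclideanSpace, Fintype.card_fin] at h1
      have h2 : ‖w‖ / d ≤ (u + ε * p) / s := by rw [div_le_iff₀ hd0]; linarith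
      have h3 := mul_le_mul_of_nonneg_left h2 hs.le
      rw [mul_div_cancel₀ _ hs.ne'] at h3
      linarith
    have hsupp := support_ball_le_frustum (n := d + 1) (m := m) (y := r * ‖w‖ / (d + 2))
      (P := α * p) (V := u - (k - α) * p) (by linarith) hm1 (by positivity)
      (by
        have : ((d : ℝ) + 1 + 1) * (r * ‖w‖ / (d + 2)) = r * ‖w‖ := by field_simp; ring
        rw [this]; linarith)
      (by
        have h1 : ((d : ℝ) + 1 - m) * (r * ‖w‖ / (d + 2)) = s * (‖w‖ / d) := by
          have : (1 : ℝ) / d = r ^ 2 := hr2.symm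
          rw [hm, hτdef, div_eq_mul_one_div ‖w‖ (d : ℝ), this]; field_simp; ring
        rw [h1]
        linear_combination hbot' - p * hmα)
    have h1 : inner ℝ (pairPt p w) (pairPt (α * t) (q⁻¹ • x)) =
        inner ℝ (pairPt (α * p) (q⁻¹ • w)) (pairPt t x) := by
      simp only [inner_pairPt, inner_smul_left, inner_smul_right, RCLike.conj_to_real]; ring
    have h2 : ‖pairPt (α * p) (q⁻¹ • w)‖ =
        √((α * p) ^ 2 + (((d : ℝ) + 1) ^ 2 - 1) * (r * ‖w‖ / (d + 2)) ^ 2) := by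
      have h3 : ‖q⁻¹ • w‖ ^ 2 = ((d : ℝ) + 2)⁻¹ * ‖w‖ ^ 2 := by
        rw [norm_smul, mul_pow, Real.norm_eq_abs, sq_abs, inv_pow, hq2]
      rw [← Real.sqrt_sq (norm_nonneg (pairPt (α * p) (q⁻¹ • w))), norm_pairPt_sq, h3, div_pow,
        mul_pow r, hr2]
      congr 2
      field_simp; ring
    have h3 := (real_inner_le_norm (pairPt (α * p) (q⁻¹ • w)) (pairPt t x)).trans
      (mul_le_of_le_one_right (norm_nonneg _) hz)
    have h4 : inner ℝ (pairPt p w) (pairPt (α * t + (k - α)) (q⁻¹ • x)) =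
        inner ℝ (pairPt p w) (pairPt (α * t) (q⁻¹ • x)) + (k - α) * p := by
      simp only [inner_pairPt]; ring
    rw [h4, h1]
    linarith
  · intro i z
    obtain ⟨t, x, rfl⟩ := exists_eq_pairPt z
    rw [pairScale_apply hβ, pairPt_add, add_zero]
    intro hz
    refine Fin.cases ?_ (fun i => ?_) i
    · have := hup 1 k 0 (fun i => by rw [inner_zero_left]; linarith) (by simp) hz
      simp only [inner_pairPt, inner_zero_left] at this
      simp only [IsRegularFamily.lift, Fin.cons_zero, inner_pairPt, inner_zero_left]
      nlinarith
    · set κ := √((d : ℝ) * (d + 2)) / (d + 1) with hκ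
      have hκ' : κ * (d + 1) = q * r * d := by
        rw [hκ, div_mul_cancel₀ _ (by positivity), Real.sqrt_mul hd0.le, hrdef, ← hq]
        have : (d : ℝ) = √(d : ℝ) * √(d : ℝ) := (Real.mul_self_sqrt hd0.le).symm
        have h0 : √(d : ℝ) ≠ 0 := (Real.sqrt_pos.2 hd0).ne'
        field_simp
        rw [sq, ← this]
      have hκ0 : 0 < κ := by positivity
      have hκq : κ * q * r * (d + 1) = d + 2 := by
        linear_combination q * r * hκ' + r ^ 2 * d * hq2 + (d + 2) * hr2'
      set N := (d : ℝ) + 1 with hN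
      have hN0 : 0 < N := by positivity
      -- The lateral plane with horizontal normal along `-Δ.points i`: it contains the bottom facet
      -- opposite that vertex and touches the top ball, hence the sign in `lift`.
      have := hup (-(N * α)⁻¹) (1 - (k - α) * (N * α)⁻¹) (-(κ * q) • Δ.points i) (fun j => ?_) ?_ hz
      · simp only [inner_pairPt, inner_smul_left, inner_smul_right, RCLike.conj_to_real] at this
        simp only [IsRegularFamily.lift, Fin.cons_succ, inner_pairPt, inner_smul_left,
          RCLike.conj_to_real]
        rw [← hN, ← hκ]
        have h1 : -(N * α)⁻¹ * (α * t + (k - α)) = -N⁻¹ * t - (k - α) * (N * α)⁻¹ := by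
          field_simp; ring
        have h2 : ∀ X : ℝ, q⁻¹ * (-(κ * q) * X) = -κ * X := fun X => by field_simp
        rw [h1, h2] at this
        linarith
      · have h1 : -inner ℝ (Δ.points i) (Δ.points j) ≤ 1 / d := by
          rcases eq_or_ne i j with rfl | hij
          · rw [real_inner_self_eq_norm_sq, h.norm_eq]
            have : 0 < 1 / (d : ℝ) := by positivity
            linarith
          · rw [h.inner_eq i j hij, neg_neg, one_div]
        rw [inner_smul_left, RCLike.conj_to_real]
        have h2 : s * (κ * q * -inner ℝ (Δ.points i) (Δ.points j)) ≤ s * (κ * q * (1 / d)) := by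
          gcongr
        have h3 : s * (κ * q * (1 / d)) * N = N - m := by
          rw [← hr2, hm, hτdef]
          linear_combination s * r * hκq
        have h4 : ε * (N * α)⁻¹ + (k - α) * (N * α)⁻¹ = m / N := by
          rw [← add_mul, add_comm ε, ← hmα]; field_simp
        have h5 : s * (κ * q * (1 / d)) = 1 - m / N := by
          rw [eq_sub_iff_add_eq, eq_comm, ← sub_eq_iff_eq_add, eq_comm]
          field_simp
          field_simp at h3
          linarith
        linarith
      · rw [norm_smul, h.norm_eq, Real.norm_eq_abs, abs_neg, abs_of_pos (mul_pos hκ0 hq0), mul_one]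
        have h1 : k * -(N * α)⁻¹ + (k - α) * (N * α)⁻¹ = -N⁻¹ := by field_simp; ring
        have h2 : r * (κ * q) = 1 + N⁻¹ := by
          field_simp
          rw [hN]; linear_combination hκq
        linarith

theorem phiJL_le_one {C : Set (Euc d)} : phiJL C ≤ 1 := by
  rw [phiJL, symMeasure]
  split_ifs
  · exact le_rfl
  · exact sub_le_self _ (div_nonneg (norm_nonneg _) ENNReal.toReal_nonneg)

/-- The two summands come from `ε / (k + ε)` and `α / (k + ε)`; the second is bounded using `τ ≤
1/√d`. Only an upper bound on the chord is needed. -/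
theorem phiJL_bodyC_le (hd : 4 ≤ d) {Δ : Affine.Simplex ℝ (Euc d) d}
    (h : IsRegularFamily Δ.points) :
    phiJL (bodyC d Δ) ≤ 1 / (d + 1 - 1 / d) + 1 / ((d + 2) * (1 - 1 / √(d : ℝ))) := by
  have hd' : (4 : ℝ) ≤ d := by exact_mod_cast hd
  have hd0 : (0 : ℝ) < d := by linarith
  have hd2 : 2 ≤ d := by lia
  have hC := bodyC_mem_convexBodies hd2 h
  obtain ⟨hk, hk2, he, hek, hlt, hs, hs2, hr, hr2⟩ := body_params hd2
  have hj := johnPoint_bodyC hd h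
  have hl := loewnerPoint_bodyC hd2 h
  have hjC : johnPoint (bodyC d Δ) ∈ bodyC d Δ :=
    (isAsymmetryCenter_johnPoint (by lia) hC).mem hC.1 (hC.2.2.mono interior_subset) (by lia)
  have hlC : loewnerPoint (bodyC d Δ) ∈ bodyC d Δ :=
    (isAsymmetryCenter_loewnerPoint (by lia) hC).mem hC.1 (hC.2.2.mono interior_subset) (by lia)
  have hup : ∀ t, pairPt t 0 ∈ bodyC d Δ → t ≤ √(1 - 1 / (d : ℝ)) := fun t ht => by
    have := inner_le_of_mem_bodyC (p := 1) (w := 0) (u := √(1 - 1 / (d : ℝ)))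
      (fun i => by rw [inner_zero_left]; linarith) (by simp) ht
    simpa [inner_pairPt] using this
  have hdown : ∀ t, pairPt t 0 ∈ bodyC d Δ → -epsSeq d ≤ t := fun t ht => by
    have := inner_le_of_mem_bodyC (p := -1) (w := 0) (u := epsSeq d)
      (fun i => by rw [inner_zero_left]; linarith) (by rw [norm_zero]; linarith) ht
    simp [inner_pairPt] at this
    linarith
  set c := √(1 - 1 / (d : ℝ)) - bodySemiaxis d with hc
  have hc0 : 0 < c := sub_pos.2 (bodySemiaxis_lt hd)
  have hnorm : ‖johnPoint (bodyC d Δ) - loewnerPoint (bodyC d Δ)‖ = c := by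
    rw [hj, hl, sub_zero]
    refine (sq_eq_sq₀ (norm_nonneg _) hc0.le).1 ?_
    simp [norm_pairPt_sq]
  have hne : johnPoint (bodyC d Δ) ≠ loewnerPoint (bodyC d Δ) := fun h0 => by
    rw [h0, sub_self, norm_zero] at hnorm; exact hc0.ne hnorm
  obtain ⟨a, b, ha, hb, hlen⟩ := exists_line_inter_eq_segment hC.1 hC.2.1 hne hjC
  have hline : ∀ t : ℝ, AffineMap.lineMap (johnPoint (bodyC d Δ)) (loewnerPoint (bodyC d Δ)) t =
      pairPt ((1 - t) * c) 0 := fun t => by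
    rw [AffineMap.lineMap_apply_module, hj, hl, smul_zero, add_zero, smul_pairPt, smul_zero]
  have ha1 := hup ((1 - a) * c) (by rw [← hline]; exact ha.1)
  have hb1 := hdown ((1 - b) * c) (by rw [← hline]; exact hb.1)
  have ha0 : a ≤ 0 := ha.2 (by simpa using hjC)
  have hb0 : 1 ≤ b := hb.2 (by simpa using hlC)
  rw [phiJL, symMeasure, if_neg hne, hlen, hnorm]
  have hpos : 0 < (b - a) * c := mul_pos (by linarith) hc0
  have h1 : c / (√(1 - 1 / (d : ℝ)) + epsSeq d) ≤ c / ((b - a) * c) :=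
    div_le_div_of_nonneg_left hc0.le hpos (by linarith)
  have hτ := bodyRatio_le hd2
  have hτ2 := one_div_sqrt_le hd
  have h2 : bodySemiaxis d / (√(1 - 1 / (d : ℝ)) + epsSeq d) =
      1 / ((d + 2) * (1 - bodyRatio d)) := by
    rw [bodySemiaxis]
    have : 0 < 1 - bodyRatio d := by linarith
    field_simp
  have h3 : 1 / ((d + 2) * (1 - bodyRatio d)) ≤ 1 / ((d + 2) * (1 - 1 / √(d : ℝ))) := by
    refine one_div_le_one_div_of_le (mul_pos (by positivity) (by linarith)) ?_
    gcongr
  have h4 : epsSeq d / (√(1 - 1 / (d : ℝ)) + epsSeq d) = 1 / (d + 1 - 1 / d) := by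
    have h5 : 1 / (d : ℝ) ≤ 1 := by rw [div_le_one hd0]; linarith
    rw [div_eq_div_iff (by linarith) (by linarith)]
    have h6 : (d : ℝ) * (1 / d) = 1 := by field_simp
    refine mul_left_cancel₀ (mul_pos (by positivity : (0 : ℝ) < d + 1) hk).ne' ?_
    linear_combination (d - 1 / d) * hek - (d + 1) * hk2 + h6
  have h7 : c / (√(1 - 1 / (d : ℝ)) + epsSeq d) = 1 - epsSeq d / (√(1 - 1 / (d : ℝ)) + epsSeq d) -
      bodySemiaxis d / (√(1 - 1 / (d : ℝ)) + epsSeq d) := by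
    rw [hc]; field_simp; ring
  linarith

end JohnBody

/-! ### Asymptotics and the infimum. -/

section Asymptotics

/-- The relative excess of the upper bound for `φ` of the bodies. -/
noncomputable def excess (d : ℕ) : ℝ :=
  if d < 4 then ((d : ℝ) + 1) / 2 - 1
  else (((d : ℝ) + 1) / (d + 1 - 1 / d) +
    (d + 1) / ((d + 2) * (1 - 1 / √(d : ℝ)))) / 2 - 1

theorem tendsto_excess : Tendsto excess atTop (𝓝 0) := by
  have h1 : Tendsto (fun d : ℕ => 1 / (d : ℝ)) atTop (𝓝 0) := tendsto_one_div_atTop_nhds_zero_nat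
  have h2 : Tendsto (fun d : ℕ => 1 / √(d : ℝ)) atTop (𝓝 0) := by
    have := h1.sqrt
    simpa using this
  have h3 : Tendsto (fun d : ℕ => ((1 + 1 / (d : ℝ)) / (1 + 1 / d - 1 / d * (1 / d)) +
      (1 + 1 / d) / ((1 + 2 * (1 / d)) * (1 - 1 / √(d : ℝ)))) / 2 - 1) atTop
      (𝓝 (((1 + 0) / (1 + 0 - 0 * 0) + (1 + 0) / ((1 + 2 * 0) * (1 - 0))) / 2 - 1)) := by
    refine (((Tendsto.div ?_ ?_ (by norm_num)).add (Tendsto.div ?_ ?_ (by norm_num))).div_const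
      2).sub_const 1
    · exact h1.const_add 1
    · exact (h1.const_add 1).sub (h1.mul h1)
    · exact h1.const_add 1
    · exact ((h1.const_mul 2).const_add 1).mul (h2.const_sub 1)
  norm_num only at h3
  refine h3.congr' ?_
  filter_upwards [eventually_ge_atTop 4] with d hd
  have hd0 : (0 : ℝ) < d := by exact_mod_cast (by lia : 0 < d)
  rw [excess, if_neg (by lia)]
  congr 3
  · rw [← mul_div_mul_left _ _ hd0.ne']
    congr 1 <;> field_simp
  · rw [← mul_div_mul_left _ _ hd0.ne', ← mul_assoc]
    congr 2 <;> field_simp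

theorem phiJL_bodyC_le_excess {d : ℕ} {Δ : Affine.Simplex ℝ (Euc d) d}
    (h : IsRegularFamily Δ.points) : phiJL (bodyC d Δ) ≤ 2 / ((d : ℝ) + 1) * (1 + excess d) := by
  rw [excess]
  split_ifs with hd
  -- For `d < 4` the value of `excess` makes the bound equal to the trivial `φ ≤ 1`.
  · refine phiJL_le_one.trans (le_of_eq ?_)
    field_simp; ring
  · refine (phiJL_bodyC_le (by lia) h).trans (le_of_eq ?_)
    have : (d : ℝ) + 1 ≠ 0 := by positivity
    have e1 : ∀ x : ℝ, ((d : ℝ) + 1) / x = (d + 1) * (1 / x) := fun x => by ring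
    rw [e1 (d + 1 - 1 / d), e1 ((d + 2) * (1 - 1 / √(d : ℝ)))]
    generalize 1 / ((d : ℝ) + 1 - 1 / d) = X
    generalize 1 / (((d : ℝ) + 2) * (1 - 1 / √(d : ℝ))) = Y
    field_simp; ring

theorem exists_convexBody_phiJL_le {d : ℕ} (hd : 2 ≤ d) :
    ∃ C ∈ convexBodies (d + 1), phiJL C ≤ 2 / ((d : ℝ) + 1) * (1 + excess d) := by
  obtain ⟨v, hv⟩ := IsRegularFamily.exists_family (d := d) (by lia)
  exact ⟨bodyC d ⟨v, hv.affineIndependent⟩, bodyC_mem_convexBodies hd hv,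
    phiJL_bodyC_le_excess hv⟩

theorem tendsto_sInf_phiJL :
    Tendsto (fun d : ℕ => ((d : ℝ) + 1) / 2 * sInf (phiJL '' convexBodies d) - 1) atTop (𝓝 0) := by
  have hlow : ∀ d : ℕ, 2 ≤ d → ∀ x ∈ phiJL '' convexBodies d, 2 / ((d : ℝ) + 1) ≤ x := by
    rintro d hd _ ⟨C, hC, rfl⟩
    exact two_div_le_phiJL hd hC
  -- `C_d` has dimension `d + 1`; the index shift costs the harmless factor `(d + 2)/(d + 1)`.
  rw [← tendsto_add_atTop_iff_nat 1]
  have h1 : Tendsto (fun d : ℕ => (1 + 1 / ((d : ℝ) + 1)) * (1 + excess d) - 1) atTop (𝓝 0) := by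
    have := ((tendsto_one_div_add_atTop_nhds_zero_nat (𝕜 := ℝ)).const_add 1).mul
      (tendsto_excess.const_add 1) |>.sub_const 1
    simpa using this
  refine tendsto_of_tendsto_of_tendsto_of_le_of_le' tendsto_const_nhds h1 ?_ ?_
  · filter_upwards [eventually_ge_atTop 2] with d hd
    obtain ⟨C, hC, -⟩ := exists_convexBody_phiJL_le hd
    have h2 := le_csInf ⟨_, mem_image_of_mem phiJL hC⟩ (hlow (d + 1) (by lia))
    rw [div_le_iff₀ (by positivity)] at h2
    linarith
  · filter_upwards [eventually_ge_atTop 2] with d hd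
    obtain ⟨C, hC, hle⟩ := exists_convexBody_phiJL_le hd
    have h2 := (csInf_le ⟨_, hlow (d + 1) (by lia)⟩ (mem_image_of_mem phiJL hC)).trans hle
    have h3 := mul_le_mul_of_nonneg_left h2 (by positivity : (0 : ℝ) ≤ (((d + 1 : ℕ) : ℝ) + 1) / 2)
    have h4 : (((d + 1 : ℕ) : ℝ) + 1) / 2 * (2 / ((d : ℝ) + 1) * (1 + excess d)) =
        (1 + 1 / ((d : ℝ) + 1)) * (1 + excess d) := by
      push_cast; field_simp
    linarith

end Asymptotics

theorem theorem6p6 :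
    (∃ δ : ℕ → ℝ, Tendsto δ atTop (𝓝 0) ∧
      ∀ d : ℕ, 2 ≤ d → ∀ Δ : Affine.Simplex ℝ (Euc d) d,
        Δ.Regular → (∀ i, ‖Δ.points i‖ = 1) →
          bodyC d Δ ∈ convexBodies (d + 1) ∧
          phiJL (bodyC d Δ) ≤ 2 / ((d : ℝ) + 1) * (1 + δ d)) ∧
    (∀ d : ℕ, 2 ≤ d → ∀ C ∈ convexBodies d, 2 / ((d : ℝ) + 1) ≤ phiJL C) ∧
    (∃ δ : ℕ → ℝ, Tendsto δ atTop (𝓝 0) ∧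
      ∀ d : ℕ, 2 ≤ d → sInf (phiJL '' convexBodies d) = 2 / ((d : ℝ) + 1) * (1 + δ d)) := by
  refine ⟨⟨excess, tendsto_excess, fun d hd Δ hΔ hn => ?_⟩, fun d hd C hC => two_div_le_phiJL hd hC,
    _, tendsto_sInf_phiJL, fun d _ => ?_⟩
  · have h := IsRegularFamily.of_equilateral (by lia) hΔ.equilateral hn
    exact ⟨bodyC_mem_convexBodies hd h, phiJL_bodyC_le_excess h⟩
  · field_simp; ring
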